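/- Let $k\ge 2$ be an integer and let $\tau=k(k-1)\cdots 1$ be the decreasing permutation of length $k$. For $n\ge 1$ let $S_n(\tau)$ be the set of permutations $\sigma$ of $\{1,\dots,n\}$ that avoid $\tau$, that is, for which there are no positions $i_1<\dots<i_k$ such that $\sigma_{i_1}\cdots\sigma_{i_k}$ is in the same relative order as $\tau$. Let $\mathbb{P}^{\tau}_n$ be the uniform probability distribution on $S_n(\tau)$, and let $\mathrm{LIS}_n(\sigma)$ be the length of the longest increasing subsequence of $\sigma$. Then: 1. whenever $0<\epsilon<k-2$, $$\lim_{n\to\infty}\mathbb{P}^{\tau}_n\left(\mathrm{LIS}_n>\frac{1+\epsilon}{k-1}\,n\right)^{1/n}=\left[(1+\epsilon)^{1+\epsilon}\left(1-\frac{\epsilon}{k-2}\right)^{k-2-\epsilon}\right]^{-\frac{2}{k-1}};$$ 2. $\mathbb{P}^{\tau}_n\left(\mathrm{LIS}_n<\frac{n}{k-1}\right)=0$ for every $n$; 3. consequently $\mathrm{LIS}_n/n\to\frac{1}{k-1}$ in probability as $n\to\infty$, that is, $\mathbb{P}^{\tau}_n\left(\left|\frac{\mathrm{LIS}_n}{n}-\frac{1}{k-1}\right|\ge\delta\right)\to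 0$ for every $\delta>0$. -/

import Mathlib

open Filter Topology

/-- The permutation `σ ∈ S_n` contains the pattern `τ ∈ S_k`: there are positions
`i_1 < ⋯ < i_k` such that `σ_{i_1} ⋯ σ_{i_k}` is in the same relative order as `τ`. -/
def ContainsPattern {n k : ℕ} (σ : Equiv.Perm (Fin n)) (τ : Equiv.Perm (Fin k)) : Prop :=
  ∃ i : Fin k → Fin n, StrictMono i ∧ ∀ a b : Fin k, σ (i a) < σ (i b) ↔ τ a < τ b

open Classical in
/-- `S_n(τ)`: the permutations of length `n` that avoid the pattern `τ`. -/
noncomputable def avoiders {k : ℕ} (τ : Equiv.Perm (Fin k)) (n : ℕ) :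
    Finset (Equiv.Perm (Fin n)) :=
  Finset.univ.filter fun σ => ¬ ContainsPattern σ τ

open Classical in
/-- `P_n^τ(E)`: the probability of the event `E` under the uniform distribution
on `S_n(τ)`. -/
noncomputable def avoidProb {k : ℕ} (τ : Equiv.Perm (Fin k)) (n : ℕ)
    (E : Equiv.Perm (Fin n) → Prop) : ℝ :=
  (((avoiders τ n).filter E).card : ℝ) / ((avoiders τ n).card : ℝ)

open Classical in
/-- `LIS_n(σ)`: the largest size of a set of positions on which `σ` is increasing. -/
noncomputable def LIS {n : ℕ} (σ : Equiv.Perm (Fin n)) : ℕ :=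
  (Finset.univ.filter fun s : Finset (Fin n) => StrictMonoOn σ (s : Set (Fin n))).sup
    Finset.card

/-- The decreasing pattern `k (k-1) ⋯ 1`. -/
def decreasingPattern (k : ℕ) : Equiv.Perm (Fin k) := Fin.revPerm

/-- For `k ≥ 2` the set `S_n(k (k-1) ⋯ 1)` contains the identity, so that the uniform
distribution on it makes sense. -/
theorem avoiders_decreasingPattern_nonempty {k : ℕ} (hk : 2 ≤ k) (n : ℕ) :
    (avoiders (decreasingPattern k) n).Nonempty := by
  refine ⟨1, ?_⟩
  simp only [avoiders, Finset.mem_filter, Finset.mem_univ, true_and]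
  rintro ⟨i, hi, h⟩
  have h01 : (⟨0, by omega⟩ : Fin k) < ⟨1, by omega⟩ := by simp
  have h1 := (h _ _).1 (by simpa using hi h01)
  simp only [decreasingPattern, Fin.revPerm_apply, Fin.rev_lt_rev] at h1
  exact absurd h1 (not_lt.2 h01.le)

/-!
Put `k = d + 2`, so that the permutations counted have no decreasing subsequence of length `d + 2`
and are unions of `d + 1` increasing ones. The theorem reduces to exponential growth rates: the
number of these permutations with `LIS σ > a * n` grows like `exp (2 * n * rate d a)` for
`1 / (d + 1) ≤ a < 1`, where `rate d a` is the entropy of a letter that is `0` with probability `a`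
and otherwise uniform among `d` further letters; and `rate d (1 / (d + 1)) = log (d + 1)` gives the
growth of the total number.

*Upper bound* (`card_filter_LIS_le_exp`). Viennot's shadow construction encodes `σ` by two words of
length `n` in `d + 1` letters, one for the positions and one for the values, each with at least
`LIS σ` zeros. The shadow of `σ` is a partial permutation whose longest decreasing subsequence is
shorter by one (`IsPartialPerm.hasDec_of_shadow`), and `σ` is recovered from its shadow together
with the columns and rows that lose their point (`IsPartialPerm.ext_of_shadow`). After `d + 1` steps
nothing is left, so the words determine `σ` (`words_injOn`). The words with at least `a * n` zeros
are counted by comparison with a product measure.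

*Lower bound* (`exp_le_card_filter_LIS`). Two words of the same content define a permutation that
matches the occurrences of each letter in order. Different pairs may give the same permutation, so
the words are made of many blocks of a fixed length and content, and each letter is shifted against
the preceding one by two blocks. Then every point with letter `r > 0` has a point with letter `r - 1`
to its left and above it, while all points there have smaller letters
(`IsBlockFamily.isInterlaced`). Hence the letters can be read off from the permutation
(`IsMatching.unique`), it has no decreasing subsequence of length `d + 2`, and its zeros form an
increasing subsequence. Blocks of the same content, with a frequency of zeros slightly above `a`,
are found in sufficient number by pigeonhole and a bound for binomial coefficients
(`exists_words_log_card`).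

The inequality `LIS σ ≥ n / (k - 1)` is the argument of Erdős and Szekeres (`le_LIS_mul`), and
convergence in probability follows since the limit in the first part is less than `1`
(`exp_rate_sub_lt_one`).
-/

/-! ### The height function of a relation and its shadow -/

open Classical in
/-- The length of the longest strictly increasing chain of points of the relation `R` in
`[0, i) × [0, j)`, given by its recursion. -/
noncomputable def height (R : ℕ → ℕ → Prop) : ℕ → ℕ → ℕ
  | 0, _ => 0
  | _ + 1, 0 => 0
  | i + 1, j + 1 =>
      max (height R i (j + 1)) (max (height R (i + 1) j) (if R i j then height R i j + 1 else 0))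
termination_by i j => i + j

/-- `R` is the graph of a partial injection of `ℕ`: each row and each column holds at most one
point. -/
structure IsPartialPerm (R : ℕ → ℕ → Prop) : Prop where
  col : ∀ {i j j'}, R i j → R i j' → j = j'
  row : ∀ {i i' j}, R i j → R i' j → i = i'

/-- Viennot's shadow of `R`: the inner corners of the level lines of `height R`, that is, the cells
at which the height increases in both directions but the line turns. For a permutation it is the
part of the insertion procedure that is passed from the first row of the tableaux to the rest. -/
def shadow (R : ℕ → ℕ → Prop) (i j : ℕ) : Prop :=
  height R (i + 1) j = height R i j + 1 ∧ height R i (j + 1) = height R i j + 1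

section Height
variable {R : ℕ → ℕ → Prop}

@[simp] theorem height_zero_left (j : ℕ) : height R 0 j = 0 := by rw [height]

@[simp] theorem height_zero_right (i : ℕ) : height R i 0 = 0 := by cases i <;> rw [height]

theorem height_le_succ_left (i j : ℕ) : height R i j ≤ height R (i + 1) j := by
  cases j with
  | zero => simp
  | succ j => rw [height.eq_3]; exact le_max_left _ _

theorem height_le_succ_right (i j : ℕ) : height R i j ≤ height R i (j + 1) := by
  cases i with
  | zero => simp
  | succ i => rw [height.eq_3]; exact (le_max_left _ _).trans (le_max_right _ _)

theorem height_mono {i i' j j' : ℕ} (hi : i ≤ i') (hj : j ≤ j') :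
    height R i j ≤ height R i' j' :=
  (monotone_nat_of_le_succ (f := fun i => height R i j) (height_le_succ_left · j) hi).trans
    (monotone_nat_of_le_succ (f := fun j => height R i' j) (height_le_succ_right i') hj)

theorem height_succ_succ_of_not {i j : ℕ} (h : ¬ R i j) :
    height R (i + 1) (j + 1) = max (height R i (j + 1)) (height R (i + 1) j) := by
  rw [height.eq_3]; simp [h]

theorem height_lt_of_rel {i j : ℕ} (h : R i j) :
    height R i j < height R (i + 1) (j + 1) := by
  rw [height.eq_3]; simp [h]

theorem height_flip (i j : ℕ) : height (flip R) j i = height R i j := by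
  induction i generalizing j with
  | zero => simp
  | succ i ih =>
    induction j with
    | zero => simp
    | succ j ihj =>
      rw [height.eq_3, height.eq_3, ih, ihj, ih, max_left_comm]; rfl

theorem height_succ_left_le (i j : ℕ) : height R (i + 1) j ≤ height R i j + 1 := by
  induction j with
  | zero => simp
  | succ j ih =>
    have := height_le_succ_right (R := R) i j
    rw [height.eq_3]
    split_ifs <;> omega

theorem height_succ_right_le (i j : ℕ) : height R i (j + 1) ≤ height R i j + 1 := by
  rw [← height_flip, ← height_flip (R := R)]; exact height_succ_left_le _ _

theorem shadow_flip : shadow (flip R) = flip (shadow R) := by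
  ext i j
  simp only [shadow, flip]
  rw [height_flip, height_flip, height_flip, and_comm]

theorem IsPartialPerm.swap (h : IsPartialPerm R) : IsPartialPerm (flip R) :=
  ⟨fun a b => h.row a b, fun a b => h.col a b⟩

/-- In a column `i` the increment `height R (i + 1) j - height R i j` is `0` or `1`. It starts
at `0`, can rise only at a point of `R`, and falls exactly at the points of the shadow. -/
theorem rel_of_rise {i j : ℕ} (h₀ : height R (i + 1) j = height R i j)
    (h₁ : height R (i + 1) (j + 1) = height R i (j + 1) + 1) : R i j := by
  by_contra h
  have := height_succ_succ_of_not h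
  have := height_le_succ_right (R := R) i j
  omega

theorem shadow_of_fall {i j : ℕ} (h₀ : height R (i + 1) j = height R i j + 1)
    (h₁ : height R (i + 1) (j + 1) = height R i (j + 1)) : shadow R i j := by
  refine ⟨h₀, ?_⟩
  have := height_le_succ_right (R := R) (i + 1) j
  have := height_succ_right_le (R := R) i j
  omega

theorem shadow.fall {i j : ℕ} (h : shadow R i j) :
    height R (i + 1) (j + 1) = height R i (j + 1) := by
  obtain ⟨h₀, h₁⟩ := h
  rw [height.eq_3]
  split_ifs <;> omega

theorem height_succ_eq_of_no_rel {i j j' : ℕ} (hj : j ≤ j')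
    (h₀ : height R (i + 1) j = height R i j) (h : ∀ m, j ≤ m → m < j' → ¬ R i m) :
    height R (i + 1) j' = height R i j' := by
  induction j', hj using Nat.le_induction with
  | base => exact h₀
  | succ m hm ih =>
    have h1 := ih fun a ha hb => h a ha (by omega)
    have h2 := mt (rel_of_rise h1) (h m hm (by omega))
    have := height_succ_left_le (R := R) i (m + 1)
    have := height_le_succ_left (R := R) i (m + 1)
    omega

theorem exists_rel_of_rise {i j j' : ℕ} (hj : j ≤ j')
    (h₀ : height R (i + 1) j = height R i j)
    (h₁ : height R (i + 1) j' = height R i j' + 1) : ∃ m, j ≤ m ∧ m < j' ∧ R i m := by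
  by_contra! h
  have := height_succ_eq_of_no_rel hj h₀ fun m hm hm' => h m hm hm'
  omega

theorem height_succ_ne_of_no_rel {i j j' : ℕ} (hj : j ≤ j')
    (h₁ : height R (i + 1) j' = height R i j' + 1) (h : ∀ m, j ≤ m → m < j' → ¬ R i m) :
    height R (i + 1) j = height R i j + 1 := by
  by_contra h₀
  have := height_succ_left_le (R := R) i j
  have := height_le_succ_left (R := R) i j
  obtain ⟨m, h1, h2, h3⟩ := exists_rel_of_rise hj (by omega) h₁
  exact h m h1 h2 h3

theorem exists_shadow_of_fall {i j j' : ℕ} (hj : j ≤ j')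
    (h₀ : height R (i + 1) j = height R i j + 1)
    (h₁ : height R (i + 1) j' = height R i j') : ∃ m, shadow R i m := by
  by_contra! h
  have key : height R (i + 1) j' = height R i j' + 1 := by
    clear h₁
    induction j', hj using Nat.le_induction with
    | base => exact h₀
    | succ m hm ih =>
      have h2 := mt (shadow_of_fall ih) (h m)
      have := height_succ_left_le (R := R) i (m + 1)
      have := height_le_succ_left (R := R) i (m + 1)
      omega
  omega

theorem shadow.exists_below {i j : ℕ} (h : shadow R i j) : ∃ m < j, R i m := by
  obtain ⟨m, -, h1, h2⟩ := exists_rel_of_rise (Nat.zero_le j) (by simp) h.1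
  exact ⟨m, h1, h2⟩

theorem shadow.exists_left {i j : ℕ} (h : shadow R i j) : ∃ m < i, R m j := by
  have : shadow (flip R) j i := by rw [shadow_flip]; exact h
  exact this.exists_below

theorem IsPartialPerm.height_of_rel (hR : IsPartialPerm R) {i j : ℕ} (h : R i j) :
    height R (i + 1) j = height R i j ∧
      height R (i + 1) (j + 1) = height R i (j + 1) + 1 := by
  have key : ∀ {S : ℕ → ℕ → Prop} {i j : ℕ}, IsPartialPerm S → S i j →
      height S (i + 1) j = height S i j := fun {S i j} hS hij =>
    height_succ_eq_of_no_rel (Nat.zero_le j) (by simp) fun m _ hm hm' =>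
      hm.ne (hS.col hm' hij)
  have h2 := key hR.swap (i := j) (j := i) h
  rw [height_flip, height_flip] at h2
  have := key hR h
  have := height_lt_of_rel h
  have := height_succ_left_le (R := R) i (j + 1)
  omega

theorem IsPartialPerm.shadow_col (hR : IsPartialPerm R) {i j j' : ℕ} (h : shadow R i j)
    (h' : shadow R i j') : j = j' := by
  have key : ∀ j j', shadow R i j → shadow R i j' → ¬ j < j' := by
    intro j j' h h' hlt
    obtain ⟨m, hm, hm'⟩ := h.exists_below
    obtain ⟨l, hl, _, hl'⟩ := exists_rel_of_rise hlt h.fall h'.1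
    have := hR.col hm' hl'
    omega
  exact le_antisymm (not_lt.1 (key _ _ h' h)) (not_lt.1 (key _ _ h h'))

theorem IsPartialPerm.shadow_isPartialPerm (hR : IsPartialPerm R) : IsPartialPerm (shadow R) where
  col := hR.shadow_col
  row {i i' j} h h' := by
    have e := shadow_flip (R := R)
    exact hR.swap.shadow_col (i := j) (by rw [e]; exact h) (by rw [e]; exact h')

theorem shadow_bounded {n : ℕ} (hb : ∀ i j, R i j → i < n ∧ j < n) :
    ∀ i j, shadow R i j → i < n ∧ j < n := by
  intro i j h
  obtain ⟨m, _, hm⟩ := h.exists_below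
  obtain ⟨l, _, hl⟩ := h.exists_left
  exact ⟨(hb _ _ hm).1, (hb _ _ hl).2⟩

/-- The columns at which the height along the upper boundary increases are those which hold a
point of `R` but none of the shadow. -/
theorem IsPartialPerm.height_succ_iff (hR : IsPartialPerm R) {n : ℕ}
    (hb : ∀ i j, R i j → i < n ∧ j < n) (i : ℕ) :
    height R (i + 1) n = height R i n + 1 ↔ (∃ j, R i j) ∧ ¬ ∃ j, shadow R i j := by
  constructor
  · intro h
    obtain ⟨m, -, _, hm⟩ := exists_rel_of_rise (Nat.zero_le n) (by simp) h
    refine ⟨⟨m, hm⟩, ?_⟩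
    rintro ⟨j, hj⟩
    obtain ⟨p, hp, hp'⟩ := hj.exists_below
    obtain ⟨l, hl, _, hl'⟩ :=
      exists_rel_of_rise (shadow_bounded hb _ _ hj).2 hj.fall h
    have := hR.col hp' hl'
    omega
  · rintro ⟨⟨j, hj⟩, h⟩
    by_contra hne
    have := height_succ_left_le (R := R) i n
    have := height_le_succ_left (R := R) i n
    exact h (exists_shadow_of_fall (hb _ _ hj).2 (hR.height_of_rel hj).2 (by omega))

/-- Between two points of the shadow in decreasing position lies a point of `R`, half-open on
either side, so that a decreasing sequence in the shadow interlaces with a longer one in `R`. -/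
theorem IsPartialPerm.exists_between (hR : IsPartialPerm R) {x y x' y' : ℕ}
    (h : shadow R x y) (h' : shadow R x' y') (hx : x < x') (hy : y' < y) :
    ∃ p q, R p q ∧ x ≤ p ∧ p < x' ∧ y' ≤ q ∧ q < y := by
  by_contra! hno
  have h1 : height R (x + 1) y' = height R x y' + 1 :=
    height_succ_ne_of_no_rel hy.le h.1 fun m hm hm' hr =>
      absurd (hno x m hr le_rfl hx hm) (by omega)
  have h2 : height R x (y' + 1) = height R x y' + 1 := by
    have h3 := h'.2
    rw [← height_flip, ← height_flip (R := R)] at h3 ⊢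
    exact height_succ_ne_of_no_rel hx.le h3 fun m hm hm' hr =>
      absurd (hno m y' hr hm hm' le_rfl) (by omega)
  -- Without such a point `(x, y')` is in the shadow too, below `(x, y)`.
  exact hy.ne (hR.shadow_col ⟨h1, h2⟩ h)

/-- `R` contains a strictly decreasing sequence of `m` points; only the values of `x` and `y` below
`m` matter. -/
def HasDec (R : ℕ → ℕ → Prop) (m : ℕ) : Prop :=
  ∃ x y : ℕ → ℕ, (∀ t < m, R (x t) (y t)) ∧ ∀ t, t + 1 < m → x t < x (t + 1) ∧ y (t + 1) < y t

/-- Passing to the shadow shortens the longest decreasing sequence. -/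
theorem IsPartialPerm.hasDec_of_shadow (hR : IsPartialPerm R) {m : ℕ}
    (h : HasDec (shadow R) (m + 1)) : HasDec R (m + 2) := by
  obtain ⟨x, y, hq, hd⟩ := h
  have key : ∀ t, ∃ p q, t < m + 2 → (R p q ∧ (t < m + 1 → p < x t ∧ y t ≤ q) ∧
      (1 ≤ t → x (t - 1) ≤ p ∧ q < y (t - 1))) := by
    intro t
    rcases Nat.eq_zero_or_pos t with rfl | ht
    · obtain ⟨p, hp, hr⟩ := (hq 0 (by omega)).exists_left
      exact ⟨p, y 0, fun _ => ⟨hr, fun _ => ⟨hp, le_rfl⟩, fun h => by omega⟩⟩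
    · obtain ⟨s, rfl⟩ : ∃ s, t = s + 1 := ⟨t - 1, by omega⟩
      simp only [Nat.add_sub_cancel]
      rcases lt_trichotomy s m with hs | rfl | hs
      · obtain ⟨h1, h2⟩ := hd s (by omega)
        obtain ⟨p, q, hr, a, b, c, d⟩ :=
          hR.exists_between (hq s (by omega)) (hq (s + 1) (by omega)) h1 h2
        exact ⟨p, q, fun _ => ⟨hr, fun _ => ⟨b, c⟩, fun _ => ⟨a, d⟩⟩⟩
      · obtain ⟨q, hlt, hr⟩ := (hq s (by omega)).exists_below
        exact ⟨x s, q, fun _ => ⟨hr, fun h => by omega, fun _ => ⟨le_rfl, hlt⟩⟩⟩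
      · exact ⟨0, 0, fun h => by omega⟩
  choose p q hpq using key
  refine ⟨p, q, fun t ht => (hpq t ht).1, fun t ht => ?_⟩
  have h1 := (hpq t (by omega)).2.1 (by omega)
  have h2 := (hpq (t + 1) ht).2.2 (by omega)
  simp only [Nat.add_sub_cancel] at h2
  omega

/-- The height is recovered from the shadow and its boundary values by going down and left: three
corners of a cell, and whether the cell is in the shadow, determine the fourth. -/
theorem height_eq_of_boundary {S : ℕ → ℕ → Prop} {n : ℕ} (hs : shadow R = shadow S)
    (hc : ∀ i ≤ n, height R i n = height S i n) (hr : ∀ j ≤ n, height R n j = height S n j)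
    (i j : ℕ) (hi : i ≤ n) (hj : j ≤ n) : height R i j = height S i j := by
  induction hi using Nat.decreasingInduction generalizing j with
  | self => exact hr j hj
  | of_succ i hi ih =>
    induction hj using Nat.decreasingInduction with
    | self => exact hc i hi.le
    | of_succ j hj ihj =>
      have e : shadow R i j ↔ shadow S i j := by rw [hs]
      simp only [shadow] at e
      have h1 := ih j hj.le
      have := height_succ_left_le (R := R) i j
      have := height_le_succ_left (R := R) i j
      have := height_succ_left_le (R := S) i j
      have := height_le_succ_left (R := S) i j
      have := height_succ_right_le (R := R) i j
      have := height_le_succ_right (R := R) i j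
      have := height_succ_right_le (R := S) i j
      have := height_le_succ_right (R := S) i j
      by_cases hd : height R (i + 1) j = height R i j + 1 ∧ height R i (j + 1) = height R i j + 1
      · have := e.1 hd
        omega
      · have := mt e.2 hd
        omega

theorem IsPartialPerm.height_right_eq {S : ℕ → ℕ → Prop} {n : ℕ} (hR : IsPartialPerm R)
    (hS : IsPartialPerm S)
    (bR : ∀ i j, R i j → i < n ∧ j < n) (bS : ∀ i j, S i j → i < n ∧ j < n)
    (hs : shadow R = shadow S) (hc : ∀ i, (∃ j, R i j) ↔ ∃ j, S i j) (i : ℕ) :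
    height R i n = height S i n := by
  induction i with
  | zero => simp
  | succ i ih =>
    have h1 := hR.height_succ_iff bR i
    have h2 := hS.height_succ_iff bS i
    rw [hc, hs, ← h2] at h1
    have := height_succ_left_le (R := R) i n
    have := height_le_succ_left (R := R) i n
    have := height_succ_left_le (R := S) i n
    have := height_le_succ_left (R := S) i n
    omega

/-- A partial permutation is determined by its shadow and by its nonempty columns and rows. -/
theorem IsPartialPerm.ext_of_shadow {S : ℕ → ℕ → Prop} {n : ℕ} (hR : IsPartialPerm R)
    (hS : IsPartialPerm S)
    (bR : ∀ i j, R i j → i < n ∧ j < n) (bS : ∀ i j, S i j → i < n ∧ j < n)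
    (hs : shadow R = shadow S) (hc : ∀ i, (∃ j, R i j) ↔ ∃ j, S i j)
    (hr : ∀ j, (∃ i, R i j) ↔ ∃ i, S i j) : R = S := by
  have hh := height_eq_of_boundary hs
    (fun i _ => hR.height_right_eq hS bR bS hs hc i) (fun j _ => by
      have := hR.swap.height_right_eq hS.swap (n := n) (fun i j h => (bR j i h).symm)
        (fun i j h => (bS j i h).symm) (by rw [shadow_flip, shadow_flip, hs]) hr j
      rwa [height_flip, height_flip] at this)
  have key : ∀ {R S : ℕ → ℕ → Prop}, IsPartialPerm R → (∀ i j, R i j → i < n ∧ j < n) →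
      (∀ i j, i ≤ n → j ≤ n → height R i j = height S i j) → ∀ i j, R i j → S i j := by
    intro R S hR bR hh i j h
    obtain ⟨hi, hj⟩ := bR i j h
    obtain ⟨h1, h2⟩ := hR.height_of_rel h
    rw [hh _ _ hi hj.le, hh _ _ hi.le hj.le] at h1
    rw [hh _ _ hi hj, hh _ _ hi.le hj] at h2
    exact rel_of_rise h1 h2
  ext i j
  exact ⟨key hR bR hh i j, key hS bS (fun i j hi hj => (hh i j hi hj).symm) i j⟩

end Height

/-! ### Iterated shadows and the coding of permutations by pairs of words -/

section Letters
variable {R : ℕ → ℕ → Prop}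

theorem IsPartialPerm.iterate_shadow (hR : IsPartialPerm R) (r : ℕ) :
    IsPartialPerm (shadow^[r] R) := by
  induction r with
  | zero => exact hR
  | succ r ih => rw [Function.iterate_succ_apply']; exact ih.shadow_isPartialPerm

theorem iterate_shadow_bounded {n : ℕ} (hb : ∀ i j, R i j → i < n ∧ j < n) (r : ℕ) :
    ∀ i j, (shadow^[r] R) i j → i < n ∧ j < n := by
  induction r with
  | zero => exact hb
  | succ r ih => rw [Function.iterate_succ_apply']; exact shadow_bounded ih

theorem iterate_shadow_flip (r : ℕ) : shadow^[r] (flip R) = flip (shadow^[r] R) := by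
  induction r with
  | zero => rfl
  | succ r ih => rw [Function.iterate_succ_apply', ih, shadow_flip, Function.iterate_succ_apply']

theorem IsPartialPerm.not_iterate_shadow (hR : IsPartialPerm R) {d : ℕ}
    (h : ¬ HasDec R (d + 1)) (i j : ℕ) : ¬ (shadow^[d] R) i j := by
  induction d generalizing R with
  | zero =>
    intro hij
    exact h ⟨fun _ => i, fun _ => j, fun _ _ => hij, fun t ht => by omega⟩
  | succ d ih =>
    rw [Function.iterate_succ_apply]
    exact ih hR.shadow_isPartialPerm fun hd => h (hR.hasDec_of_shadow hd)

/-- The number of iterated shadows, beginning with the first, that have a point in column `i`. For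
a permutation this is the row, counted from `0`, in which `i` stands in the recording tableau. The
value is `0` if no shadow is ever free of the column. -/
noncomputable def shadowLetter (R : ℕ → ℕ → Prop) (i : ℕ) : ℕ :=
  sInf {r | ¬ ∃ j, (shadow^[r + 1] R) i j}

theorem exists_col_iterate_shadow_of_le {i r s : ℕ} (hrs : r ≤ s)
    (h : ∃ j, (shadow^[s] R) i j) : ∃ j, (shadow^[r] R) i j := by
  induction s, hrs using Nat.le_induction with
  | base => exact h
  | succ m _ ih =>
    obtain ⟨j, hj⟩ := h
    rw [Function.iterate_succ_apply'] at hj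
    obtain ⟨l, -, hl⟩ := hj.exists_below
    exact ih ⟨l, hl⟩

theorem lt_shadowLetter_iff {d : ℕ} (h0 : ∀ i j, ¬ (shadow^[d + 1] R) i j) {r i : ℕ} :
    r < shadowLetter R i ↔ ∃ j, (shadow^[r + 1] R) i j := by
  have hne : {r | ¬ ∃ j, (shadow^[r + 1] R) i j}.Nonempty := ⟨d, by simpa using h0 i⟩
  constructor
  · intro h
    by_contra hr
    exact Nat.notMem_of_lt_sInf h hr
  · intro h
    by_contra hr
    exact Nat.sInf_mem hne (exists_col_iterate_shadow_of_le (by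
      have := not_lt.1 hr
      rw [shadowLetter] at this
      omega) h)

theorem shadowLetter_lt {d : ℕ} (h0 : ∀ i j, ¬ (shadow^[d + 1] R) i j) (i : ℕ) :
    shadowLetter R i < d + 1 :=
  Nat.lt_succ_of_le (Nat.sInf_le (by simpa using h0 i))

/-- If the shadows die out after `d + 1` steps, the letters of the columns and of the rows
determine the relation. -/
theorem IsPartialPerm.ext_of_shadowLetter {S : ℕ → ℕ → Prop} {n d : ℕ} (hR : IsPartialPerm R)
    (hS : IsPartialPerm S)
    (bR : ∀ i j, R i j → i < n ∧ j < n) (bS : ∀ i j, S i j → i < n ∧ j < n)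
    (hR0 : ∀ i j, ¬ (shadow^[d + 1] R) i j) (hS0 : ∀ i j, ¬ (shadow^[d + 1] S) i j)
    (hc : ∀ i, (∃ j, R i j) ↔ ∃ j, S i j) (hr : ∀ j, (∃ i, R i j) ↔ ∃ i, S i j)
    (hlc : ∀ i < n, shadowLetter R i = shadowLetter S i)
    (hlr : ∀ j < n, shadowLetter (flip R) j = shadowLetter (flip S) j) : R = S := by
  have key : ∀ {R S : ℕ → ℕ → Prop}, (∀ i j, R i j → i < n ∧ j < n) →
      (∀ i j, S i j → i < n ∧ j < n) →
      (∀ i j, ¬ (shadow^[d + 1] R) i j) → (∀ i j, ¬ (shadow^[d + 1] S) i j) →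
      (∀ i, (∃ j, R i j) ↔ ∃ j, S i j) →
      (∀ i < n, shadowLetter R i = shadowLetter S i) →
      ∀ r i, (∃ j, (shadow^[r] R) i j) ↔ ∃ j, (shadow^[r] S) i j := by
    intro R S bR bS hR0 hS0 hc hl r i
    cases r with
    | zero => exact hc i
    | succ r =>
      rcases lt_or_ge i n with hi | hi
      · rw [← lt_shadowLetter_iff hR0, ← lt_shadowLetter_iff hS0, hl i hi]
      · exact iff_of_false
          (fun ⟨j, hj⟩ => absurd (iterate_shadow_bounded bR _ _ _ hj).1 (by omega))
          (fun ⟨j, hj⟩ => absurd (iterate_shadow_bounded bS _ _ _ hj).1 (by omega))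
  have cols := key bR bS hR0 hS0 hc hlc
  have rows := key (R := flip R) (S := flip S) (fun i j h => (bR j i h).symm)
    (fun i j h => (bS j i h).symm)
    (by intro i j; rw [iterate_shadow_flip]; exact hR0 j i)
    (by intro i j; rw [iterate_shadow_flip]; exact hS0 j i) hr hlr
  have main : ∀ r ≤ d + 1, shadow^[r] R = shadow^[r] S := by
    intro r hrd
    induction hrd using Nat.decreasingInduction with
    | self => ext i j; exact iff_of_false (hR0 i j) (hS0 i j)
    | of_succ r _ ih =>
      rw [Function.iterate_succ_apply', Function.iterate_succ_apply'] at ih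
      refine (hR.iterate_shadow r).ext_of_shadow (hS.iterate_shadow r)
        (iterate_shadow_bounded bR r) (iterate_shadow_bounded bS r) ih (cols r) fun j => ?_
      have := rows r j
      rwa [iterate_shadow_flip, iterate_shadow_flip] at this
  exact main 0 (Nat.zero_le _)

theorem IsPartialPerm.height_le_card (hR : IsPartialPerm R) {n : ℕ}
    (hb : ∀ i j, R i j → i < n ∧ j < n) (m : ℕ) :
    height R m n ≤ ((Finset.range m).filter fun i => shadowLetter R i = 0).card := by
  induction m with
  | zero => simp
  | succ m ih =>
    rw [Finset.range_add_one, Finset.filter_insert]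
    have h1 := height_succ_left_le (R := R) m n
    have h2 := hR.height_succ_iff hb m
    split_ifs with h
    · rw [Finset.card_insert_of_notMem (by simp)]
      omega
    · have : ¬ height R (m + 1) n = height R m n + 1 := by
        rw [h2]
        rintro ⟨-, hno⟩
        exact h (Nat.sInf_eq_zero.2 (Or.inl hno))
      omega

end Letters

section PermGraph
variable {n : ℕ}

/-- The graph of a permutation of `Fin n`, as a relation on `ℕ`. -/
def permGraph (σ : Equiv.Perm (Fin n)) (i j : ℕ) : Prop :=
  ∃ h : i < n, (σ ⟨i, h⟩ : ℕ) = j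

theorem permGraph_isPartialPerm (σ : Equiv.Perm (Fin n)) : IsPartialPerm (permGraph σ) where
  col := by rintro i j j' ⟨h, rfl⟩ ⟨_, rfl⟩; rfl
  row := by
    rintro i i' j ⟨h, h1⟩ ⟨h', h2⟩
    have := σ.injective (Fin.ext (h1.trans h2.symm))
    simpa using this

theorem permGraph_bounded (σ : Equiv.Perm (Fin n)) :
    ∀ i j, permGraph σ i j → i < n ∧ j < n := by
  rintro i j ⟨h, rfl⟩; exact ⟨h, (σ _).2⟩

theorem permGraph_injective : Function.Injective (permGraph (n := n)) := by
  intro σ τ h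
  ext i
  have : permGraph σ i (σ i) := ⟨i.2, rfl⟩
  rw [h] at this
  obtain ⟨_, h2⟩ := this
  exact h2.symm

theorem exists_permGraph_iff (σ : Equiv.Perm (Fin n)) (i : ℕ) : (∃ j, permGraph σ i j) ↔ i < n :=
  ⟨fun ⟨_, h, _⟩ => h, fun h => ⟨_, h, rfl⟩⟩

theorem exists_permGraph_iff' (σ : Equiv.Perm (Fin n)) (j : ℕ) :
    (∃ i, permGraph σ i j) ↔ j < n :=
  ⟨fun ⟨_, h⟩ => (permGraph_bounded σ _ _ h).2,
    fun h => ⟨σ.symm ⟨j, h⟩, (σ.symm ⟨j, h⟩).2, by simp⟩⟩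

theorem containsPattern_of_hasDec {d : ℕ} {σ : Equiv.Perm (Fin n)}
    (h : HasDec (permGraph σ) (d + 1)) : ContainsPattern σ (decreasingPattern (d + 1)) := by
  obtain ⟨x, y, hr, hd⟩ := h
  choose hx hy using hr
  refine ⟨fun t => ⟨x t, hx t t.2⟩, ?_, ?_⟩
  · rw [Fin.strictMono_iff_lt_succ]
    intro t
    exact (hd t (by omega)).1
  · have hanti : StrictAnti fun t : Fin (d + 1) => σ ⟨x t, hx t t.2⟩ := by
      rw [Fin.strictAnti_iff_succ_lt]
      intro t
      rw [Fin.lt_def, hy _ (Fin.is_lt _), hy _ (Fin.is_lt _)]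
      exact (hd t (by omega)).2
    intro a b
    simp only [decreasingPattern, Fin.revPerm_apply, Fin.rev_lt_rev]
    exact hanti.lt_iff_gt

theorem mem_avoiders {k : ℕ} {τ : Equiv.Perm (Fin k)} {σ : Equiv.Perm (Fin n)} :
    σ ∈ avoiders τ n ↔ ¬ ContainsPattern σ τ := by simp [avoiders]

theorem le_LIS {σ : Equiv.Perm (Fin n)} {s : Finset (Fin n)}
    (hs : StrictMonoOn σ (s : Set (Fin n))) : s.card ≤ LIS σ := by
  classical
  rw [LIS]
  exact Finset.le_sup (f := Finset.card) (by simpa using hs)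

theorem exists_card_eq_LIS (σ : Equiv.Perm (Fin n)) :
    ∃ s : Finset (Fin n), StrictMonoOn σ (s : Set (Fin n)) ∧ s.card = LIS σ := by
  classical
  obtain ⟨s, hs, h⟩ := Finset.exists_mem_eq_sup
    (Finset.univ.filter fun s : Finset (Fin n) => StrictMonoOn σ (s : Set (Fin n)))
    ⟨∅, by simp [StrictMonoOn]⟩ Finset.card
  exact ⟨s, by simpa using hs, by rw [LIS]; convert h.symm⟩

theorem LIS_le (σ : Equiv.Perm (Fin n)) : LIS σ ≤ n := by
  obtain ⟨s, -, hs⟩ := exists_card_eq_LIS σ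
  simpa [hs] using s.card_le_univ

/-- The height dominates every increasing subsequence, hence `LIS`. The converse is true but plays
no role. -/
theorem card_le_height {σ : Equiv.Perm (Fin n)} {s : Finset (Fin n)}
    (hs : StrictMonoOn σ (s : Set (Fin n))) (i : Fin n) (hi : i ∈ s) :
    (s.filter (· ≤ i)).card ≤ height (permGraph σ) (i + 1) (σ i + 1) := by
  induction i using WellFoundedLT.induction with
  | ind i ih =>
    have hlt : height (permGraph σ) i (σ i) < height (permGraph σ) (i + 1) (σ i + 1) :=
      height_lt_of_rel ⟨i.2, rfl⟩
    have hsplit : s.filter (· ≤ i) = insert i (s.filter (· < i)) := by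
      ext a
      simp only [Finset.mem_filter, Finset.mem_insert, le_iff_lt_or_eq]
      grind
    rw [hsplit, Finset.card_insert_of_notMem (by simp)]
    rcases (s.filter (· < i)).eq_empty_or_nonempty with h | h
    · rw [h]; simp; omega
    · have hm := Finset.max'_mem _ h
      set m := (s.filter (· < i)).max' h with hmdef
      rw [Finset.mem_filter] at hm
      have h1 := ih m hm.2 hm.1
      have h2 : s.filter (· < i) ⊆ s.filter (· ≤ m) := by
        intro a ha
        exact Finset.mem_filter.2 ⟨(Finset.mem_filter.1 ha).1, Finset.le_max' _ _ ha⟩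
      have h3 := Finset.card_le_card h2
      have h4 : height (permGraph σ) (m + 1) (σ m + 1) ≤ height (permGraph σ) i (σ i) :=
        height_mono hm.2 (hs hm.1 hi hm.2)
      omega

theorem LIS_le_height (σ : Equiv.Perm (Fin n)) : LIS σ ≤ height (permGraph σ) n n := by
  obtain ⟨s, hs, hc⟩ := exists_card_eq_LIS σ
  rw [← hc]
  rcases s.eq_empty_or_nonempty with rfl | h
  · simp
  · have h1 := card_le_height hs _ (s.max'_mem h)
    rw [Finset.filter_true_of_mem fun a ha => s.le_max' a ha] at h1
    exact h1.trans (height_mono (Fin.is_lt _) (Fin.is_lt _))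

/-- The word that lists the shadow letters of the positions of `σ`. -/
noncomputable def posWord (σ : Equiv.Perm (Fin n)) (i : Fin n) : ℕ := shadowLetter (permGraph σ) i

/-- The word that lists the shadow letters of the values of `σ`. -/
noncomputable def valWord (σ : Equiv.Perm (Fin n)) (j : Fin n) : ℕ :=
  shadowLetter (flip (permGraph σ)) j

theorem not_iterate_shadow_permGraph {d : ℕ} {σ : Equiv.Perm (Fin n)}
    (h : σ ∈ avoiders (decreasingPattern (d + 2)) n) (i j : ℕ) :
    ¬ (shadow^[d + 1] (permGraph σ)) i j :=
  (permGraph_isPartialPerm σ).not_iterate_shadow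
    (fun hd => mem_avoiders.1 h (containsPattern_of_hasDec hd)) i j

theorem posWord_lt {d : ℕ} {σ : Equiv.Perm (Fin n)}
    (h : σ ∈ avoiders (decreasingPattern (d + 2)) n) (i : Fin n) : posWord σ i < d + 1 :=
  shadowLetter_lt (not_iterate_shadow_permGraph h) i

theorem valWord_lt {d : ℕ} {σ : Equiv.Perm (Fin n)}
    (h : σ ∈ avoiders (decreasingPattern (d + 2)) n) (i : Fin n) : valWord σ i < d + 1 :=
  shadowLetter_lt (by
    intro i j
    rw [iterate_shadow_flip]
    exact not_iterate_shadow_permGraph h j i) i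

/-- A permutation without a decreasing subsequence of length `d + 2` is determined by its two words,
which are words in `d + 1` letters. -/
theorem words_injOn (d : ℕ) :
    Set.InjOn (fun σ : Equiv.Perm (Fin n) => (posWord σ, valWord σ))
      (avoiders (decreasingPattern (d + 2)) n : Set (Equiv.Perm (Fin n))) := by
  intro σ hσ τ hτ h
  simp only [Prod.mk.injEq] at h
  apply permGraph_injective
  refine (permGraph_isPartialPerm σ).ext_of_shadowLetter (permGraph_isPartialPerm τ)
    (permGraph_bounded σ) (permGraph_bounded τ) (not_iterate_shadow_permGraph hσ)
    (not_iterate_shadow_permGraph hτ) ?_ ?_ ?_ ?_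
  · intro i; rw [exists_permGraph_iff, exists_permGraph_iff]
  · intro i; rw [exists_permGraph_iff', exists_permGraph_iff']
  · exact fun i hi => congrFun h.1 ⟨i, hi⟩
  · exact fun i hi => congrFun h.2 ⟨i, hi⟩

theorem card_filter_range_eq (p : ℕ → Prop) [DecidablePred p] :
    ((Finset.range n).filter p).card = (Finset.univ.filter fun i : Fin n => p i).card := by
  symm
  refine Finset.card_bij (fun i _ => (i : ℕ)) (fun i hi => ?_) (fun i _ j _ => Fin.ext)
    fun i hi => ?_
  · simpa using hi
  · obtain ⟨h1, h2⟩ := Finset.mem_filter.1 hi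
    exact ⟨⟨i, Finset.mem_range.1 h1⟩, by simpa using h2, rfl⟩

theorem LIS_le_card_posWord (σ : Equiv.Perm (Fin n)) :
    LIS σ ≤ (Finset.univ.filter fun i => posWord σ i = 0).card := by
  refine (LIS_le_height σ).trans ?_
  refine ((permGraph_isPartialPerm σ).height_le_card (permGraph_bounded σ) n).trans_eq ?_
  rw [card_filter_range_eq]; rfl

theorem LIS_le_card_valWord (σ : Equiv.Perm (Fin n)) :
    LIS σ ≤ (Finset.univ.filter fun i => valWord σ i = 0).card := by
  refine (LIS_le_height σ).trans ?_
  rw [← height_flip]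
  refine ((permGraph_isPartialPerm σ).swap.height_le_card (n := n)
    (fun i j h => (permGraph_bounded σ j i h).symm) n).trans_eq ?_
  rw [card_filter_range_eq]; rfl

end PermGraph

/-! ### Upper bounds -/

open Classical in
/-- The words of length `n` in the letters `0, …, d` in which the letter `0` has frequency at least
`a`. -/
noncomputable def wordsWithZeros (d n : ℕ) (a : ℝ) : Finset (Fin n → ℕ) :=
  (Fintype.piFinset fun _ : Fin n => Finset.range (d + 1)).filter fun u =>
    a * n ≤ ((Finset.univ.filter fun i => u i = 0).card : ℝ)

open Classical in
theorem card_filter_LIS_le (d n : ℕ) (a : ℝ) :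
    ((avoiders (decreasingPattern (d + 2)) n).filter fun σ => a * n ≤ (LIS σ : ℝ)).card ≤
      (wordsWithZeros d n a).card ^ 2 := by
  rw [pow_two, ← Finset.card_product]
  refine Finset.card_le_card_of_injOn (fun σ => (posWord σ, valWord σ)) ?_
    ((words_injOn d).mono (Finset.coe_subset.2 (Finset.filter_subset _ _)))
  intro σ hσ
  obtain ⟨h1, h2⟩ := Finset.mem_filter.1 hσ
  simp only [Finset.coe_product, Set.mem_prod, Finset.mem_coe, wordsWithZeros, Finset.mem_filter,
    Fintype.mem_piFinset, Finset.mem_range]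
  exact ⟨⟨posWord_lt h1, h2.trans (by exact_mod_cast LIS_le_card_posWord σ)⟩,
    ⟨valWord_lt h1, h2.trans (by exact_mod_cast LIS_le_card_valWord σ)⟩⟩

/-- The entropy, in nats, of the distribution on `d + 1` letters that gives the letter `0` the
probability `a` and the others equal probabilities: the exponential growth rate of the number of
words with a proportion `a` of zeros. -/
noncomputable def rate (d : ℕ) (a : ℝ) : ℝ := Real.binEntropy a + (1 - a) * Real.log d

/-- Under the product measure in which `0` has probability `a` and every other letter
`(1 - a) / d`, all words together have weight `1`, and, since `0` is the likeliest letter, each word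
with at least `a * n` zeros has weight at least `exp (-n * rate d a)`. -/
theorem card_wordsWithZeros_le {d : ℕ} (hd : 1 ≤ d) (n : ℕ) {a : ℝ} (ha : 1 / (d + 1 : ℝ) ≤ a)
    (ha1 : a < 1) : ((wordsWithZeros d n a).card : ℝ) ≤ Real.exp (n * rate d a) := by
  have hd0 : (0 : ℝ) < d := by exact_mod_cast hd
  have ha0 : 0 < a := lt_of_lt_of_le (by positivity) ha
  set b : ℝ := (1 - a) / d with hb
  have hb0 : 0 < b := div_pos (by linarith) hd0
  have hba : b ≤ a := by
    rw [hb, div_le_iff₀ hd0]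
    rw [div_le_iff₀ (by positivity)] at ha
    linarith
  have hrate : Real.exp (n * rate d a) = (a ^ (a * n) * b ^ ((1 - a) * n))⁻¹ := by
    rw [Real.rpow_def_of_pos ha0, Real.rpow_def_of_pos hb0, ← Real.exp_add, ← Real.exp_neg, hb,
      Real.log_div (by linarith) hd0.ne', rate, Real.binEntropy, Real.log_inv, Real.log_inv]
    congr 1; ring
  have hpos : 0 < a ^ (a * n) * b ^ ((1 - a) * n) := by positivity
  rw [hrate, ← one_div, le_div_iff₀ hpos]
  let w : ℕ → ℝ := fun c => if c = 0 then a else b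
  have hw : ∑ c ∈ Finset.range (d + 1), w c = 1 := by
    rw [Finset.sum_range_succ']
    simp [w, hb]
    field_simp
    ring
  have htot : ∑ u ∈ Fintype.piFinset (fun _ : Fin n => Finset.range (d + 1)), ∏ i, w (u i) = 1 := by
    rw [← Finset.prod_univ_sum]; simp [hw]
  calc ((wordsWithZeros d n a).card : ℝ) * (a ^ (a * n) * b ^ ((1 - a) * n))
      = ∑ u ∈ wordsWithZeros d n a, a ^ (a * n) * b ^ ((1 - a) * n) := by simp
    _ ≤ ∑ u ∈ wordsWithZeros d n a, ∏ i, w (u i) := by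
        refine Finset.sum_le_sum fun u hu => ?_
        have hz := (Finset.mem_filter.1 hu).2
        rw [Finset.prod_ite, Finset.prod_const, Finset.prod_const]
        set z := (Finset.univ.filter fun i => u i = 0).card with hzdef
        have hz' : ((Finset.univ.filter fun i => ¬ u i = 0).card : ℝ) = n - z := by
          have := Finset.card_filter_add_card_filter_not (s := Finset.univ) (fun i => u i = 0)
          rw [Finset.card_univ, Fintype.card_fin] at this
          rw [eq_sub_iff_add_eq, add_comm]
          exact_mod_cast this
        rw [← Real.rpow_natCast a, ← Real.rpow_natCast b, hz']
        have e1 : (a : ℝ) ^ (z : ℝ) = a ^ (a * n) * a ^ (z - a * n) := by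
          rw [← Real.rpow_add ha0]; congr 1; ring
        have e2 : (b : ℝ) ^ ((1 - a) * n) = b ^ ((n : ℝ) - z) * b ^ (z - a * n) := by
          rw [← Real.rpow_add hb0]; congr 1; ring
        rw [e1, e2, mul_assoc, mul_comm (b ^ ((n : ℝ) - z))]
        gcongr
    _ ≤ ∑ u ∈ Fintype.piFinset (fun _ : Fin n => Finset.range (d + 1)), ∏ i, w (u i) := by
        refine Finset.sum_le_sum_of_subset_of_nonneg (Finset.filter_subset _ _) fun u _ _ => ?_
        refine Finset.prod_nonneg fun i _ => ?_
        simp only [w]; split_ifs <;> positivity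
    _ = 1 := htot

open Classical in
theorem card_filter_LIS_le_exp {d : ℕ} (hd : 1 ≤ d) (n : ℕ) {a : ℝ} (ha : 1 / (d + 1 : ℝ) ≤ a)
    (ha1 : a < 1) :
    (((avoiders (decreasingPattern (d + 2)) n).filter fun σ => a * n ≤ (LIS σ : ℝ)).card : ℝ) ≤
      Real.exp (n * (2 * rate d a)) := by
  calc _ ≤ ((wordsWithZeros d n a).card : ℝ) ^ 2 := by exact_mod_cast card_filter_LIS_le d n a
    _ ≤ Real.exp (n * rate d a) ^ 2 := by
        gcongr; exact card_wordsWithZeros_le hd n ha ha1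
    _ = _ := by rw [← Real.exp_nat_mul]; congr 1; push_cast; ring

theorem card_avoiders_le_exp {d n : ℕ} :
    ((avoiders (decreasingPattern (d + 2)) n).card : ℝ) ≤
      Real.exp (n * (2 * Real.log (d + 1))) := by
  have h : (avoiders (decreasingPattern (d + 2)) n).card ≤ ((d + 1) ^ n) ^ 2 := by
    have e : (Fintype.piFinset fun _ : Fin n => Finset.range (d + 1)).card = (d + 1) ^ n := by simp
    rw [← e, pow_two, ← Finset.card_product]
    refine Finset.card_le_card_of_injOn (fun σ => (posWord σ, valWord σ)) ?_ (words_injOn d)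
    intro σ h1
    simp only [Finset.coe_product, Set.mem_prod, Finset.mem_coe,
      Fintype.mem_piFinset, Finset.mem_range]
    exact ⟨posWord_lt h1, valWord_lt h1⟩
  calc ((avoiders (decreasingPattern (d + 2)) n).card : ℝ) ≤ ((d + 1 : ℝ) ^ n) ^ 2 := by
        exact_mod_cast h
    _ = _ := by
        rw [← pow_mul, ← Real.rpow_natCast, Real.rpow_def_of_pos (by positivity)]
        congr 1; push_cast; ring

/-! ### Permutations from pairs of words -/

section Matching

/-- `σ` sends the `m`-th occurrence of each letter in the word `U` to its `m`-th occurrence in the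
word `V`. Words are functions on `ℕ` of which only the first `n` values matter. -/
structure IsMatching {n : ℕ} (U V : ℕ → ℕ) (σ : Equiv.Perm (Fin n)) : Prop where
  letter : ∀ i : Fin n, V (σ i) = U i
  mono : ∀ i j : Fin n, i < j → U i = U j → σ i < σ j

theorem count_ofFn (U : ℕ → ℕ) (n r : ℕ) :
    (List.ofFn fun i : Fin n => U i).count r = Nat.count (U · = r) n := by
  induction n with
  | zero => simp
  | succ n ih =>
    rw [List.ofFn_succ', List.concat_eq_append, List.count_append, Nat.count_succ]
    simp only [Fin.val_castSucc, ih, Fin.val_last, List.count_singleton, beq_iff_eq]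

/-- Two words of the same content are matched by some permutation: sort both of them stably. -/
theorem exists_isMatching {U V : ℕ → ℕ} {n : ℕ}
    (h : ∀ r, Nat.count (U · = r) n = Nat.count (V · = r) n) :
    ∃ σ : Equiv.Perm (Fin n), IsMatching U V σ := by
  set u : Fin n → ℕ := fun i => U i with hu
  set v : Fin n → ℕ := fun i => V i with hv
  have hperm : (List.ofFn u).Perm (List.ofFn v) :=
    List.perm_iff_count.2 fun r => by rw [count_ofFn, count_ofFn, h]
  have hsort : u ∘ Tuple.sort u = v ∘ Tuple.sort v := by
    apply List.ofFn_injective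
    refine List.Perm.eq_of_sortedLE ?_ ?_ ?_
    · exact (Tuple.monotone_sort u).sortedLE_ofFn
    · exact (Tuple.monotone_sort v).sortedLE_ofFn
    · exact ((Equiv.Perm.ofFn_comp_perm _ u).trans hperm).trans
        (Equiv.Perm.ofFn_comp_perm _ v).symm
  have hlet : ∀ i, v (Tuple.sort v ((Tuple.sort u).symm i)) = u i := fun i => by
    have := congrFun hsort ((Tuple.sort u).symm i)
    simpa using this.symm
  refine ⟨(Tuple.sort u).symm.trans (Tuple.sort v), hlet, fun i j hij he => ?_⟩
  have hsu := (Tuple.eq_sort_iff (f := u)).1 rfl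
  have hsv := (Tuple.eq_sort_iff (f := v)).1 rfl
  refine hsv.2 _ _ ?_ (by rw [hlet, hlet]; exact he)
  by_contra hlt
  rcases (not_lt.1 hlt).lt_or_eq with h1 | h1
  · have := hsu.2 _ _ h1 (by simpa using he.symm)
    simp only [Equiv.apply_symm_apply] at this
    exact absurd this hij.asymm
  · exact hij.ne ((Tuple.sort u).symm.injective h1.symm)

theorem count_eq_card {n : ℕ} (p : ℕ → Prop) [DecidablePred p] {x : ℕ} (hx : x ≤ n) :
    Nat.count p x = (Finset.univ.filter fun i : Fin n => (i : ℕ) < x ∧ p i).card := by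
  rw [Nat.count_eq_card_filter_range, ← card_filter_range_eq (fun i => i < x ∧ p i)]
  congr 1
  ext i
  simp only [Finset.mem_filter, Finset.mem_range]
  constructor
  · rintro ⟨h, h'⟩; exact ⟨by omega, h, h'⟩
  · rintro ⟨-, h⟩; exact h

/-- Comparison of the letter counts at matched positions `x` of `U` and `y` of `V`: the larger
letters are at least as advanced in `V` as in `U`, the smaller ones strictly less advanced. It makes
the letter of a point of the matching permutation equal to the number of points, other than itself,
on a longest decreasing subsequence that ends there, so that the words can be read off from the
permutation. -/
structure IsInterlaced (d n : ℕ) (U V : ℕ → ℕ) : Prop where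
  lt : ∀ x < n, U x < d
  le : ∀ x < n, ∀ y < n, V y = U x →
    Nat.count (U · = U x) x = Nat.count (V · = U x) y → ∀ r < d, U x < r →
      Nat.count (U · = r) x ≤ Nat.count (V · = r) y
  gt : ∀ x < n, ∀ y < n, V y = U x →
    Nat.count (U · = U x) x = Nat.count (V · = U x) y → ∀ r < U x,
      Nat.count (V · = r) y < Nat.count (U · = r) x

variable {d n : ℕ} {U V : ℕ → ℕ} {σ : Equiv.Perm (Fin n)}

theorem IsMatching.count_eq (h : IsMatching U V σ) (i : Fin n) :
    Nat.count (U · = U i) i = Nat.count (V · = U i) (σ i) := by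
  rw [count_eq_card _ i.2.le, count_eq_card _ (σ i).2.le]
  refine Finset.card_bij (fun a _ => σ a) (fun a ha => ?_) (fun a _ b _ => σ.injective.eq_iff.1)
    fun b hb => ?_
  · simp only [Finset.mem_filter, Finset.mem_univ, true_and] at ha ⊢
    exact ⟨h.mono _ _ ha.1 ha.2, (h.letter a).trans ha.2⟩
  · simp only [Finset.mem_filter, Finset.mem_univ, true_and] at hb
    obtain ⟨a, rfl⟩ := σ.surjective b
    rw [h.letter] at hb
    refine ⟨a, ?_, rfl⟩
    simp only [Finset.mem_filter, Finset.mem_univ, true_and]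
    refine ⟨?_, hb.2⟩
    by_contra hlt
    rcases (not_lt.1 hlt).lt_or_eq with h1 | h1
    · exact absurd (h.mono _ _ h1 hb.2.symm) (lt_asymm hb.1)
    · rw [Fin.ext h1] at hb
      exact lt_irrefl _ hb.1

theorem IsMatching.letter_lt (h : IsMatching U V σ) (hI : IsInterlaced d n U V) {i j : Fin n}
    (hij : i < j) (hσ : σ j < σ i) : U i < U j := by
  by_contra hlt
  rcases (not_lt.1 hlt).lt_or_eq with h1 | h1
  · have h2 := hI.le j j.2 (σ j) (σ j).2 (h.letter j) (h.count_eq j) _ (hI.lt i i.2) h1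
    have h3 : Nat.count (U · = U i) i < Nat.count (U · = U i) j :=
      Nat.count_strict_mono rfl hij
    have h4 : Nat.count (V · = U i) (σ j) ≤ Nat.count (V · = U i) (σ i) :=
      Nat.count_monotone _ (le_of_lt hσ)
    have := h.count_eq i
    omega
  · exact absurd (h.mono i j hij h1.symm) hσ.asymm

theorem IsMatching.exists_letter (h : IsMatching U V σ) (hI : IsInterlaced d n U V) {j : Fin n}
    {r : ℕ} (hr : r < U j) : ∃ i < j, σ j < σ i ∧ U i = r := by
  have h1 := hI.gt j j.2 (σ j) (σ j).2 (h.letter j) (h.count_eq j) r hr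
  by_contra! hno
  refine h1.not_ge ?_
  rw [count_eq_card _ j.2.le, count_eq_card _ (σ j).2.le]
  refine Finset.card_le_card_of_injOn σ (fun a ha => ?_) σ.injective.injOn
  simp only [Finset.coe_filter, Finset.mem_univ, true_and, Set.mem_ofPred_eq] at ha ⊢
  refine ⟨?_, (h.letter a).trans ha.2⟩
  by_contra hlt
  rcases (not_lt.1 hlt).lt_or_eq with h2 | h2
  · exact hno a ha.1 h2 ha.2
  · exact absurd (σ.injective (Fin.ext h2)) (ne_of_gt ha.1)

/-- The points that precede position `i` in a maximal chain for the first pair of words have, in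
the second pair, letters that increase strictly along the chain. -/
theorem IsMatching.letter_le {U' V' : ℕ → ℕ} (h : IsMatching U V σ) (hI : IsInterlaced d n U V)
    (h' : IsMatching U' V' σ) (hI' : IsInterlaced d n U' V') (i : Fin n) : U i ≤ U' i := by
  have key : ∀ r, ∀ i : Fin n, U i = r → r ≤ U' i := by
    intro r
    induction r with
    | zero => intro i _; exact Nat.zero_le _
    | succ r ih =>
      intro j hj
      obtain ⟨i, hij, hσ, hi⟩ := h.exists_letter hI (j := j) (r := r) (by omega)
      have := ih i hi
      have := h'.letter_lt hI' hij hσ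
      omega
  exact key _ i rfl

/-- The matching permutation determines both words. -/
theorem IsMatching.unique {U' V' : ℕ → ℕ} (h : IsMatching U V σ) (hI : IsInterlaced d n U V)
    (h' : IsMatching U' V' σ) (hI' : IsInterlaced d n U' V') :
    (∀ x < n, U x = U' x) ∧ ∀ y < n, V y = V' y := by
  have hU : ∀ i : Fin n, U i = U' i := fun i =>
    le_antisymm (h.letter_le hI h' hI' i) (h'.letter_le hI' h hI i)
  refine ⟨fun x hx => hU ⟨x, hx⟩, fun y hy => ?_⟩
  obtain ⟨i, hi⟩ := σ.surjective ⟨y, hy⟩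
  have e : y = (σ i : ℕ) := by rw [hi]
  rw [e, h.letter, h'.letter, hU]

theorem mem_avoiders_of_coloring {d : ℕ} {f : Fin n → ℕ} (hf : ∀ i, f i < d)
    (h : ∀ i j, i < j → σ j < σ i → f i < f j) :
    σ ∈ avoiders (decreasingPattern (d + 1)) n := by
  rw [mem_avoiders]
  rintro ⟨p, hp, hpat⟩
  have key : ∀ t, ∀ ht : t < d + 1, t ≤ f (p ⟨t, ht⟩) := by
    intro t
    induction t with
    | zero => intro _; exact Nat.zero_le _
    | succ t ih =>
      intro ht
      have h1 := ih (by omega)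
      have hlt : (⟨t, by omega⟩ : Fin (d + 1)) < ⟨t + 1, ht⟩ := by simp
      have h2 := h _ _ (hp hlt) ((hpat _ _).2
        (by simp [decreasingPattern]))
      omega
  exact absurd (hf (p ⟨d, by omega⟩)) (not_lt.2 (key d (by omega)))

theorem IsMatching.mem_avoiders (h : IsMatching U V σ) (hI : IsInterlaced d n U V) :
    σ ∈ avoiders (decreasingPattern (d + 1)) n :=
  mem_avoiders_of_coloring (f := fun i => U i) (fun i => hI.lt i i.2)
    fun _ _ hij hσ => h.letter_lt hI hij hσ

theorem IsMatching.count_le_LIS (h : IsMatching U V σ) (r : ℕ) :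
    Nat.count (U · = r) n ≤ LIS σ := by
  rw [count_eq_card _ le_rfl]
  refine le_LIS fun i hi j hj hij => ?_
  simp only [Finset.coe_filter, Finset.mem_univ, true_and, Set.mem_ofPred_eq] at hi hj
  exact h.mono i j hij (hi.2.trans hj.2.symm)

end Matching

/-! ### Words made of blocks -/

section Words

theorem count_congr' {p q : ℕ → Prop} [DecidablePred p] [DecidablePred q] {n : ℕ}
    (h : ∀ k < n, (p k ↔ q k)) : Nat.count p n = Nat.count q n :=
  le_antisymm (Nat.count_mono_left fun k hk => (h k hk).1)
    (Nat.count_mono_left fun k hk => (h k hk).2)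

/-- There is a nondecreasing word with `e r` letters `r` for each `r < d`. The order is expressed
by the letter counts before each position. -/
theorem exists_sorted_word (d : ℕ) (e : ℕ → ℕ) :
    ∃ S : ℕ → ℕ, (∀ r < d, Nat.count (S · = r) (∑ r ∈ Finset.range d, e r) = e r) ∧
      ∀ z < ∑ r ∈ Finset.range d, e r, S z < d ∧ ∀ r < d,
        (S z < r → Nat.count (S · = r) z = 0) ∧ (r < S z → Nat.count (S · = r) z = e r) := by
  induction d with
  | zero => exact ⟨id, by simp⟩
  | succ d ih =>
    obtain ⟨S, h1, h2⟩ := ih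
    set E := ∑ r ∈ Finset.range d, e r with hE
    have hlow : ∀ r, ∀ z ≤ E, Nat.count ((fun z => if z < E then S z else d) · = r) z =
        Nat.count (S · = r) z := fun r z hz =>
      count_congr' fun k hk => by simp [show k < E by omega]
    have hup : ∀ r z, Nat.count ((fun z => if z < E then S z else d) · = r) (E + z) =
        Nat.count (S · = r) E + if r = d then z else 0 := by
      intro r z
      rw [Nat.count_add, hlow r E le_rfl]
      congr 1
      split_ifs with h
      · rw [Nat.count_iff_forall]
        intro k _; simp [h]
      · rw [Nat.count_iff_forall_not]
        intro k _; simpa using Ne.symm h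
    have hd : ∀ z ≤ E, Nat.count (S · = d) z = 0 := by
      intro z hz
      rw [Nat.count_iff_forall_not]
      exact fun m hm => (h2 m (by omega)).1.ne
    refine ⟨fun z => if z < E then S z else d, fun r hr => ?_, fun z hz => ?_⟩
    · rw [Finset.sum_range_succ, ← hE, hup]
      rcases Nat.lt_succ_iff_lt_or_eq.1 hr with h | rfl
      · simp [h1 r h, h.ne]
      · simp [hd]
    · rcases lt_or_ge z E with hzE | hzE
      · simp only [hzE, if_true]
        refine ⟨(h2 z hzE).1.trans (Nat.lt_succ_self d), fun r hr => ?_⟩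
        rw [hlow r z hzE.le]
        rcases Nat.lt_succ_iff_lt_or_eq.1 hr with h | rfl
        · exact (h2 z hzE).2 r h
        · exact ⟨fun _ => hd z hzE.le, fun h => absurd (h2 z hzE).1 h.asymm⟩
      · simp only [not_lt.2 hzE, if_false]
        refine ⟨Nat.lt_succ_self d, fun r hr => ⟨fun h => by omega, fun h => ?_⟩⟩
        obtain ⟨y, rfl⟩ := Nat.exists_eq_add_of_le hzE
        rw [hup]
        simp [h1 r h, h.ne]

/-- The word that consists of the blocks `f 0, …, f (M - 1)`, of length `L` each, followed by
`S`. -/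
def blockWord (M L : ℕ) (f : ℕ → ℕ → ℕ) (S : ℕ → ℕ) (x : ℕ) : ℕ :=
  if x < M * L then f (x / L) (x % L) else S (x - M * L)

theorem blockWord_block {M L : ℕ} {f : ℕ → ℕ → ℕ} {S : ℕ → ℕ} {t o : ℕ} (ht : t < M) (ho : o < L) :
    blockWord M L f S (t * L + o) = f t o := by
  have h1 : t * L + o < M * L := by
    calc t * L + o < (t + 1) * L := by rw [add_mul]; omega
      _ ≤ M * L := Nat.mul_le_mul_right _ ht
  rw [blockWord, if_pos h1, Nat.add_comm, Nat.add_mul_div_right _ _ (by omega),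
    Nat.add_mul_mod_self_right, Nat.div_eq_of_lt ho, Nat.mod_eq_of_lt ho, zero_add]

theorem blockWord_suffix {M L : ℕ} {f : ℕ → ℕ → ℕ} {S : ℕ → ℕ} (z : ℕ) :
    blockWord M L f S (M * L + z) = S z := by
  simp [blockWord]

/-- The first `M` blocks `f t` are words of length `L` in `d` letters that begin with
`0, 1, …, d - 1` and have the same content `c`. -/
structure IsBlockFamily (d M L : ℕ) (c : ℕ → ℕ) (f : ℕ → ℕ → ℕ) : Prop where
  lt : ∀ t < M, ∀ o < L, f t o < d
  start : ∀ t < M, ∀ o < d, f t o = o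
  count : ∀ t < M, ∀ r < d, Nat.count (f t · = r) L = c r

variable {d M L : ℕ} {c : ℕ → ℕ} {f : ℕ → ℕ → ℕ} {S : ℕ → ℕ}

theorem IsBlockFamily.count_mul (h : IsBlockFamily d M L c f) {r : ℕ} (hr : r < d) {t : ℕ}
    (ht : t ≤ M) : Nat.count (blockWord M L f S · = r) (t * L) = t * c r := by
  induction t with
  | zero => simp
  | succ t ih =>
    rw [add_mul, one_mul, Nat.count_add, ih (by omega), add_mul, one_mul, ← h.count t ht r hr]
    congr 1
    exact count_congr' fun k hk => by rw [blockWord_block ht hk]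

theorem IsBlockFamily.count_add (h : IsBlockFamily d M L c f) {r : ℕ} (hr : r < d) {t : ℕ}
    (ht : t < M) {o : ℕ} (ho : o ≤ L) :
    Nat.count (blockWord M L f S · = r) (t * L + o) = t * c r + Nat.count (f t · = r) o := by
  rw [Nat.count_add, h.count_mul hr ht.le]
  congr 1
  exact count_congr' fun k hk => by rw [blockWord_block ht (by omega)]

theorem IsBlockFamily.count_suffix (h : IsBlockFamily d M L c f) {r : ℕ} (hr : r < d) (z : ℕ) :
    Nat.count (blockWord M L f S · = r) (M * L + z) = M * c r + Nat.count (S · = r) z := by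
  rw [Nat.count_add, h.count_mul hr le_rfl]
  congr 1
  exact count_congr' fun k hk => by rw [blockWord_suffix]

/-- The letter counts before a position `x` of a block word: either `x` lies in some block `t`, or
in the sorted suffix. -/
theorem IsBlockFamily.position (h : IsBlockFamily d M L c f) {e : ℕ → ℕ}
    (hS : ∀ z < ∑ r ∈ Finset.range d, e r, S z < d ∧ ∀ r < d,
        (S z < r → Nat.count (S · = r) z = 0) ∧ (r < S z → Nat.count (S · = r) z = e r))
    {x : ℕ} (hx : x < M * L + ∑ r ∈ Finset.range d, e r) :
    blockWord M L f S x < d ∧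
    ((∃ t < M, (∀ r < d, t * c r ≤ Nat.count (blockWord M L f S · = r) x ∧
        Nat.count (blockWord M L f S · = r) x ≤ (t + 1) * c r) ∧
        Nat.count (blockWord M L f S · = blockWord M L f S x) x <
          (t + 1) * c (blockWord M L f S x) ∧
        ∀ r < blockWord M L f S x, 1 ≤ Nat.count (blockWord M L f S · = r) x) ∨
      (∀ r < d, M * c r ≤ Nat.count (blockWord M L f S · = r) x ∧
        (blockWord M L f S x < r → Nat.count (blockWord M L f S · = r) x = M * c r) ∧
        (r < blockWord M L f S x → Nat.count (blockWord M L f S · = r) x = M * c r + e r))) := by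
  rcases lt_or_ge x (M * L) with hxM | hxM
  · have hL : 0 < L := Nat.pos_of_ne_zero (by rintro rfl; simp at hxM)
    obtain ⟨t, o, ho, rfl⟩ : ∃ t o, o < L ∧ x = t * L + o :=
      ⟨x / L, x % L, Nat.mod_lt _ hL, (Nat.div_add_mod' x L).symm⟩
    have ht : t < M := by
      by_contra hge
      have := Nat.mul_le_mul_right L (not_lt.1 hge)
      omega
    rw [blockWord_block ht ho]
    have hlt := h.lt t ht o ho
    refine ⟨hlt, Or.inl ⟨t, ht, fun r hr => ?_, ?_, fun r hr => ?_⟩⟩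
    · rw [h.count_add hr ht ho.le, add_mul, one_mul, ← h.count t ht r hr]
      exact ⟨Nat.le_add_right _ _, Nat.add_le_add_left (Nat.count_monotone _ ho.le) _⟩
    · rw [h.count_add hlt ht ho.le, add_mul, one_mul, ← h.count t ht _ hlt]
      exact Nat.add_lt_add_left (Nat.count_strict_mono (p := (f t · = f t o)) rfl ho) _
    · have hrd := hr.trans hlt
      rw [h.count_add hrd ht ho.le]
      have hro : r < o := by
        by_contra hge
        have := h.start t ht o (by omega)
        omega
      have : Nat.count (f t · = r) r < Nat.count (f t · = r) o :=
        Nat.count_strict_mono (h.start t ht r hrd) hro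
      omega
  · obtain ⟨z, rfl⟩ := Nat.exists_eq_add_of_le hxM
    rw [blockWord_suffix]
    obtain ⟨h1, h2⟩ := hS z (by omega)
    refine ⟨h1, Or.inr fun r hr => ?_⟩
    rw [h.count_suffix hr]
    refine ⟨Nat.le_add_right _ _, fun hlt => ?_, fun hlt => ?_⟩
    · rw [(h2 r hr).1 hlt, add_zero]
    · rw [(h2 r hr).2 hlt]

theorem count_reverse {U : ℕ → ℕ} {n r : ℕ} {y : ℕ} (hy : y ≤ n) :
    Nat.count (fun y => U (n - 1 - y) = r) y + Nat.count (U · = r) (n - y) =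
      Nat.count (U · = r) n := by
  induction y with
  | zero => simp
  | succ y ih =>
    rw [← ih (by omega), Nat.count_succ, show n - y = n - (y + 1) + 1 by omega, Nat.count_succ,
      show n - 1 - y = n - (y + 1) by omega]
    omega

/-- A block word and the reversal of another one are interlaced when the suffix has `2 * r * c r`
letters `r`, except that there may be more of the largest letter. In the reversal the suffix
comes first, so that the letter `r` runs `2 * r` blocks ahead of the letter `0`: this lag exceeds
the fluctuations inside one block. -/
theorem IsBlockFamily.isInterlaced {f' : ℕ → ℕ → ℕ} {e : ℕ → ℕ} (hM : 0 < M)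
    (h : IsBlockFamily d M L c f) (h' : IsBlockFamily d M L c f')
    (hSe : ∀ r < d, Nat.count (S · = r) (∑ r ∈ Finset.range d, e r) = e r)
    (hS : ∀ z < ∑ r ∈ Finset.range d, e r, S z < d ∧ ∀ r < d,
        (S z < r → Nat.count (S · = r) z = 0) ∧ (r < S z → Nat.count (S · = r) z = e r))
    (he : ∀ r < d, 2 * r * c r ≤ e r) (he' : ∀ r, r + 1 < d → e r ≤ 2 * r * c r)
    (hc : ∀ r < d, 0 < c r) {n : ℕ} (hn : n = M * L + ∑ r ∈ Finset.range d, e r) :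
    IsInterlaced d n (blockWord M L f S) (fun y => blockWord M L f' S (n - 1 - y)) := by
  set U := blockWord M L f S with hU
  set U' := blockWord M L f' S with hU'
  have htot : ∀ r < d, Nat.count (U' · = r) n = M * c r + e r := fun r hr => by
    rw [hn, h'.count_suffix hr, hSe r hr]
  have key : ∀ x < n, ∀ y < n, U' (n - 1 - y) = U x →
      Nat.count (U · = U x) x = Nat.count (fun y => U' (n - 1 - y) = U x) y →
      ∀ r < d, (U x < r →
        Nat.count (U · = r) x ≤ Nat.count (fun y => U' (n - 1 - y) = r) y) ∧
        (r < U x → Nat.count (fun y => U' (n - 1 - y) = r) y < Nat.count (U · = r) x) := by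
    intro x hx y hy hxy hcount r hr
    obtain ⟨hxd, hpx⟩ := h.position hS (x := x) (by omega)
    obtain ⟨-, hpy⟩ := h'.position hS (x := n - 1 - y) (by omega)
    rw [← hU] at hpx hxd
    rw [← hU', hxy] at hpy
    have hrev := fun r => count_reverse (U := U') (n := n) (r := r) hy.le
    simp only [show n - y = n - 1 - y + 1 by omega, Nat.count_succ, hxy] at hrev
    have hq := hrev (U x)
    have hrr := hrev r
    rw [htot _ hxd] at hq
    rw [htot _ hr] at hrr
    rw [if_pos rfl] at hq
    generalize U x = q at *
    generalize Nat.count (fun y => U' (n - 1 - y) = q) y = Vq at *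
    generalize Nat.count (fun y => U' (n - 1 - y) = r) y = Vr at *
    have hcr := hc r hr
    have hcq := hc q hxd
    have her := he r hr
    have heq := he q hxd
    constructor
    · intro hlt
      rw [if_neg hlt.ne] at hrr
      have heq' := he' q (by omega)
      rcases hpx with ⟨t, ht, hx1, hx2, hx3⟩ | hx1 <;> rcases hpy with ⟨s, hs, hy1, hy2, hy3⟩ | hy1
      · have a1 := (hx1 q hxd).1
        have a2 := (hy1 q hxd).1
        have b1 := (hx1 r hr).2
        have b2 := (hy1 r hr).2
        have : (t + s) * c q < (M + 2 * q) * c q := by rw [add_mul, add_mul]; omega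
        have := Nat.lt_of_mul_lt_mul_right this
        have : (t + 1 + (s + 1)) * c r ≤ (M + 2 * r) * c r := Nat.mul_le_mul_right _ (by omega)
        rw [add_mul (t + 1), add_mul M] at this
        omega
      · have a1 := (hx1 q hxd).1
        have a2 := (hy1 q hxd).1
        have b1 := (hx1 r hr).2
        have b2 := (hy1 r hr).2.1 hlt
        have : t * c q < (2 * q) * c q := by omega
        have := Nat.lt_of_mul_lt_mul_right this
        have : (t + 1) * c r ≤ (2 * r) * c r := Nat.mul_le_mul_right _ (by omega)
        omega
      · have a1 := (hx1 q hxd).1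
        have a2 := (hy1 q hxd).1
        have b1 := (hx1 r hr).2.1 hlt
        have b2 := (hy1 r hr).2
        have : s * c q < (2 * q) * c q := by omega
        have := Nat.lt_of_mul_lt_mul_right this
        have : (s + 1) * c r ≤ (2 * r) * c r := Nat.mul_le_mul_right _ (by omega)
        omega
      · have a1 := (hx1 q hxd).1
        have a2 := (hy1 q hxd).1
        have b1 := (hx1 r hr).2.1 hlt
        have b2 := (hy1 r hr).2.1 hlt
        have : M * c q < (2 * q) * c q := by omega
        have := Nat.lt_of_mul_lt_mul_right this
        have : M * c r ≤ (2 * r) * c r := Nat.mul_le_mul_right _ (by omega)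
        omega
    · intro hlt
      rw [if_neg hlt.ne'] at hrr
      have her' := he' r (by omega)
      rcases hpx with ⟨t, ht, hx1, hx2, hx3⟩ | hx1 <;> rcases hpy with ⟨s, hs, hy1, hy2, hy3⟩ | hy1
      · have b1 := (hx1 r hr).1
        have b2 := (hy1 r hr).1
        have : (M + 2 * q) * c q < (t + 1 + (s + 1)) * c q := by
          rw [add_mul M, add_mul (t + 1)]; omega
        have := Nat.lt_of_mul_lt_mul_right this
        have : (M + 2 * r + 1) * c r ≤ (t + s) * c r := Nat.mul_le_mul_right _ (by omega)
        rw [add_mul, add_mul, one_mul, add_mul] at this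
        omega
      · have b1 := hx3 r hlt
        have b2 := (hy1 r hr).2.2 hlt
        omega
      · have b1 := hy3 r hlt
        have b2 := (hx1 r hr).2.2 hlt
        omega
      · have b1 := (hx1 r hr).2.2 hlt
        have b2 := (hy1 r hr).2.2 hlt
        have : 0 < M * c r := Nat.mul_pos hM hcr
        omega
  refine ⟨fun x hx => (h.position hS (by omega)).1, fun x hx y hy hxy hcount r hr hlt =>
    (key x hx y hy hxy hcount r hr).1 hlt, fun x hx y hy hxy hcount r hlt =>
    (key x hx y hy hxy hcount r (hlt.trans (h.position hS (by omega)).1)).2 hlt⟩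

end Words

/-! ### Counting permutations that come from block words -/

section BlockCount

/-- The block `0, 1, …, d - 1` followed by the word `p t`, of length `d + B` in all. Outside the
range of the indices the value is `0`. -/
def familyBlock (d : ℕ) {M B : ℕ} (p : Fin M → Fin B → ℕ) (t o : ℕ) : ℕ :=
  if o < d then o else if h : t < M ∧ o - d < B then p ⟨t, h.1⟩ ⟨o - d, h.2⟩ else 0

theorem familyBlock_start {d M B : ℕ} (p : Fin M → Fin B → ℕ) (t : ℕ) {o : ℕ} (ho : o < d) :
    familyBlock d p t o = o := if_pos ho

theorem familyBlock_add {d M B : ℕ} (p : Fin M → Fin B → ℕ) (t : Fin M) (o : Fin B) :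
    familyBlock d p t (d + o) = p t o := by
  simp [familyBlock]

theorem isBlockFamily_familyBlock {d M B : ℕ} {W : Finset (Fin B → ℕ)} {c : ℕ → ℕ}
    (hlt : ∀ w ∈ W, ∀ o, w o < d)
    (hc : ∀ w ∈ W, ∀ r < d, (Finset.univ.filter fun o => w o = r).card = c r)
    {p : Fin M → Fin B → ℕ} (hp : ∀ t, p t ∈ W) :
    IsBlockFamily d M (d + B) (fun r => c r + 1) (familyBlock d p) where
  lt t ht o ho := by
    rcases lt_or_ge o d with h | h
    · rwa [familyBlock_start p t h]
    · obtain ⟨m, rfl⟩ := Nat.exists_eq_add_of_le h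
      rw [familyBlock_add p ⟨t, ht⟩ ⟨m, by omega⟩]
      exact hlt _ (hp _) _
  start t _ o ho := familyBlock_start p t ho
  count t ht r hr := by
    rw [Nat.count_add, add_comm]
    congr 1
    · rw [count_eq_card _ le_rfl, ← hc _ (hp ⟨t, ht⟩) r hr]
      congr 1
      ext o
      simp [familyBlock_add p ⟨t, ht⟩ o]
    · rw [Nat.count_eq_card_filter_range, Finset.card_eq_one]
      refine ⟨r, ?_⟩
      ext o
      simp only [Finset.mem_filter, Finset.mem_range, Finset.mem_singleton]
      constructor
      · rintro ⟨h1, h2⟩; rwa [familyBlock_start p t h1] at h2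
      · rintro rfl; exact ⟨hr, familyBlock_start p t hr⟩

open Classical in
/-- A set `W` of words of equal content yields `W.card ^ (2 * M)` permutations of the same length:
choose `M` words for the positions and `M` for the values. The zeros of the words form an increasing
subsequence. The parameter `z` adjusts the length to any large `n`. -/
theorem pow_card_le_card_avoiders {d B : ℕ} (hd : 0 < d) {W : Finset (Fin B → ℕ)} {c : ℕ → ℕ}
    (hlt : ∀ w ∈ W, ∀ o, w o < d)
    (hc : ∀ w ∈ W, ∀ r < d, (Finset.univ.filter fun o => w o = r).card = c r)
    {M : ℕ} (hM : 0 < M) (z n : ℕ)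
    (hn : n = M * (d + B) + (∑ r ∈ Finset.range d, 2 * r * (c r + 1) + z)) :
    W.card ^ (2 * M) ≤
      ((avoiders (decreasingPattern (d + 1)) n).filter fun σ => M * c 0 < LIS σ).card := by
  set e : ℕ → ℕ := fun r => 2 * r * (c r + 1) + if r = d - 1 then z else 0 with he
  have hE : ∑ r ∈ Finset.range d, e r = ∑ r ∈ Finset.range d, 2 * r * (c r + 1) + z := by
    rw [he, Finset.sum_add_distrib, Finset.sum_ite_eq', if_pos (Finset.mem_range.2 (by omega))]
  obtain ⟨S, hS1, hS2⟩ := exists_sorted_word d e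
  rw [← hE] at hn
  have hfam : ∀ {p : Fin M → Fin B → ℕ}, (∀ t, p t ∈ W) →
      IsBlockFamily d M (d + B) (fun r => c r + 1) (familyBlock d p) :=
    isBlockFamily_familyBlock hlt hc
  set word : (Fin M → Fin B → ℕ) → ℕ → ℕ := fun p => blockWord M (d + B) (familyBlock d p) S
    with hword
  have hinter : ∀ {p q : Fin M → Fin B → ℕ}, (∀ t, p t ∈ W) → (∀ t, q t ∈ W) →
      IsInterlaced d n (word p) (fun y => word q (n - 1 - y)) := fun hp hq =>
    (hfam hp).isInterlaced hM (hfam hq) hS1 hS2 (fun r _ => Nat.le_add_right _ _)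
      (fun r hr => by simp [he, show r ≠ d - 1 by omega]) (fun r _ => Nat.succ_pos _) hn
  have hcount : ∀ {p : Fin M → Fin B → ℕ}, (∀ t, p t ∈ W) → ∀ r < d,
      Nat.count (word p · = r) n = M * (c r + 1) + e r := fun hp r hr => by
    rw [hn, hword, (hfam hp).count_suffix hr, hS1 r hr]
  have hex : ∀ x : (Fin M → Fin B → ℕ) × (Fin M → Fin B → ℕ), ∃ σ : Equiv.Perm (Fin n),
      (∀ t, x.1 t ∈ W) → (∀ t, x.2 t ∈ W) →
        IsMatching (word x.1) (fun y => word x.2 (n - 1 - y)) σ := by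
    rintro ⟨p, q⟩
    by_cases h : (∀ t, p t ∈ W) ∧ ∀ t, q t ∈ W
    · obtain ⟨hp, hq⟩ := h
      obtain ⟨σ, hσ⟩ := exists_isMatching (U := word p) (V := fun y => word q (n - 1 - y))
        (n := n) (fun r => by
          have h1 := count_reverse (U := word q) (n := n) (r := r) le_rfl
          rw [Nat.sub_self, Nat.count_zero, add_zero] at h1
          rw [h1]
          rcases lt_or_ge r d with hr | hr
          · rw [hcount hp r hr, hcount hq r hr]
          · rw [Nat.count_iff_forall_not.2, Nat.count_iff_forall_not.2]
            · exact fun m hm => (((hinter hq hp).lt m hm).trans_le hr).ne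
            · exact fun m hm => (((hinter hp hq).lt m hm).trans_le hr).ne)
      exact ⟨σ, fun _ _ => hσ⟩
    · exact ⟨1, fun hp hq => absurd ⟨hp, hq⟩ h⟩
  choose σ hσ using hex
  have hcard : W.card ^ (2 * M) = ((Fintype.piFinset fun _ : Fin M => W) ×ˢ
      (Fintype.piFinset fun _ : Fin M => W)).card := by
    rw [Finset.card_product, Fintype.card_piFinset_const, two_mul, pow_add]
  rw [hcard]
  refine Finset.card_le_card_of_injOn σ ?_ ?_
  · intro x hx
    simp only [Finset.coe_product, Set.mem_prod, Finset.mem_coe, Fintype.mem_piFinset] at hx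
    have hm := hσ x hx.1 hx.2
    refine Finset.mem_coe.2 (Finset.mem_filter.2 ⟨hm.mem_avoiders (hinter hx.1 hx.2), ?_⟩)
    have := hm.count_le_LIS 0
    rw [hcount hx.1 0 hd, mul_add] at this
    omega
  · intro x hx x' hx' hxx
    simp only [Finset.coe_product, Set.mem_prod, Finset.mem_coe, Fintype.mem_piFinset] at hx hx'
    have hm := hσ x hx.1 hx.2
    rw [hxx] at hm
    obtain ⟨hU, hV⟩ := hm.unique (hinter hx.1 hx.2) (hσ x' hx'.1 hx'.2) (hinter hx'.1 hx'.2)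
    have key : ∀ p q : Fin M → Fin B → ℕ, (∀ x < n, word p x = word q x) → p = q := by
      intro p q h
      ext t o
      have h1 : (t : ℕ) * (d + B) + (d + o) < n := by
        have : ((t : ℕ) + 1) * (d + B) ≤ M * (d + B) := Nat.mul_le_mul_right _ t.2
        rw [add_mul] at this
        have := o.2
        omega
      have h2 := h _ h1
      simp only [hword] at h2
      rwa [blockWord_block t.2 (by omega), blockWord_block t.2 (by omega), familyBlock_add,
        familyBlock_add] at h2
    refine Prod.ext (key _ _ hU) (key _ _ fun y hy => ?_)
    have := hV (n - 1 - y) (by omega)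
    simpa [show n - 1 - (n - 1 - y) = y by omega] using this

end BlockCount

/-! ### Many words of equal content -/

section WordCount

theorem card_words_zeros (d B L : ℕ) :
    ((Fintype.piFinset fun _ : Fin B => Finset.range (d + 1)).filter
      fun w => (Finset.univ.filter fun o => w o = 0).card = L).card =
      B.choose L * d ^ (B - L) := by
  classical
  have hmaps : ∀ w ∈ (Fintype.piFinset fun _ : Fin B => Finset.range (d + 1)).filter
      (fun w => (Finset.univ.filter fun o => w o = 0).card = L),
      (Finset.univ.filter fun o => w o = 0) ∈ Finset.powersetCard L (Finset.univ : Finset (Fin B)) :=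
    fun w hw => Finset.mem_powersetCard.2 ⟨Finset.subset_univ _, (Finset.mem_filter.1 hw).2⟩
  rw [Finset.card_eq_sum_card_fiberwise hmaps]
  have hfib : ∀ A ∈ Finset.powersetCard L (Finset.univ : Finset (Fin B)),
      (((Fintype.piFinset fun _ : Fin B => Finset.range (d + 1)).filter
        fun w => (Finset.univ.filter fun o => w o = 0).card = L).filter
        fun w => (Finset.univ.filter fun o => w o = 0) = A).card = d ^ (B - L) := by
    intro A hA
    have hAc := (Finset.mem_powersetCard.1 hA).2
    have heq : (((Fintype.piFinset fun _ : Fin B => Finset.range (d + 1)).filter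
        fun w => (Finset.univ.filter fun o => w o = 0).card = L).filter
        fun w => (Finset.univ.filter fun o => w o = 0) = A) =
        Fintype.piFinset fun o : Fin B => if o ∈ A then {0} else (Finset.range (d + 1)).erase 0 := by
      ext w
      simp only [Finset.mem_filter, Fintype.mem_piFinset]
      constructor
      · rintro ⟨⟨h1, -⟩, rfl⟩ o
        by_cases h : w o = 0
        · simp [h]
        · simpa [h] using h1 o
      · intro h
        have hz : (Finset.univ.filter fun o => w o = 0) = A := by
          ext o
          have := h o
          simp only [Finset.mem_filter, Finset.mem_univ, true_and]
          split_ifs at this with hoA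
          · simpa [hoA] using this
          · simp only [Finset.mem_erase] at this
            exact iff_of_false this.1 hoA
        refine ⟨⟨fun o => ?_, by rw [hz, hAc]⟩, hz⟩
        have := h o
        split_ifs at this
        · simp only [Finset.mem_singleton] at this
          simp [this]
        · exact Finset.mem_of_mem_erase this
    rw [heq, Fintype.card_piFinset]
    simp only [apply_ite Finset.card, Finset.card_singleton]
    rw [Finset.prod_ite, Finset.prod_const_one, one_mul, Finset.prod_const,
      Finset.card_erase_of_mem (by simp), Finset.card_range, Nat.add_sub_cancel]
    congr 1
    have := Finset.card_filter_add_card_filter_not (s := Finset.univ) (fun o => o ∈ A)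
    rw [Finset.card_univ, Fintype.card_fin, Finset.filter_univ_mem, hAc] at this
    omega
  rw [Finset.sum_congr rfl hfib, Finset.sum_const, Finset.card_powersetCard, Finset.card_univ,
    Fintype.card_fin, smul_eq_mul]

/-- Pigeonhole: there are at most `(B + 1) ^ (d + 1)` contents. -/
theorem exists_words_same_content {d B L : ℕ} (hd : 0 < d) (hL : L ≤ B) :
    ∃ (W : Finset (Fin B → ℕ)) (c : ℕ → ℕ), (∀ w ∈ W, ∀ o, w o < d + 1) ∧
      (∀ w ∈ W, ∀ r < d + 1, (Finset.univ.filter fun o => w o = r).card = c r) ∧ c 0 = L ∧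
      B.choose L * d ^ (B - L) ≤ W.card * (B + 1) ^ (d + 1) := by
  classical
  set s := (Fintype.piFinset fun _ : Fin B => Finset.range (d + 1)).filter
    fun w => (Finset.univ.filter fun o => w o = 0).card = L with hs
  set t := Fintype.piFinset fun _ : Fin (d + 1) => Finset.range (B + 1) with ht
  set f : (Fin B → ℕ) → Fin (d + 1) → ℕ := fun w r => (Finset.univ.filter fun o => w o = r).card
    with hf
  have hmaps : ∀ w ∈ s, f w ∈ t := fun w _ => Fintype.mem_piFinset.2 fun r =>
    Finset.mem_range.2 (Nat.lt_succ_of_le (by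
      simpa using Finset.card_le_univ (Finset.univ.filter fun o => w o = r)))
  obtain ⟨y, -, hy⟩ := Finset.exists_max_image t (fun y => (s.filter (fun w => f w = y)).card)
    ⟨0, by simp [ht]⟩
  have hcard := Finset.card_le_mul_card_image_of_maps_to hmaps _ hy
  rw [hs, card_words_zeros, ht, Fintype.card_piFinset_const, Finset.card_range, ← hs] at hcard
  have hne : (s.filter fun w => f w = y).Nonempty := by
    rw [← Finset.card_pos]
    refine Nat.pos_of_ne_zero fun h => ?_
    rw [h, zero_mul] at hcard
    have : 0 < B.choose L * d ^ (B - L) := Nat.mul_pos (Nat.choose_pos hL) (pow_pos hd _)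
    omega
  have hcont : ∀ w ∈ s.filter (fun w => f w = y), ∀ r, ∀ hr : r < d + 1,
      (Finset.univ.filter fun o => w o = r).card = y ⟨r, hr⟩ := fun w hw r hr =>
    congrFun (Finset.mem_filter.1 hw).2 ⟨r, hr⟩
  refine ⟨s.filter fun w => f w = y, fun r => if h : r < d + 1 then y ⟨r, h⟩ else 0,
    fun w hw o => ?_, fun w hw r hr => ?_, ?_, hcard⟩
  · have h1 := (Finset.mem_filter.1 (Finset.mem_filter.1 hw).1).1
    exact Finset.mem_range.1 (Fintype.mem_piFinset.1 h1 o)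
  · rw [hcont w hw r hr]
    simp only [hr, dite_true]
  · obtain ⟨w, hw⟩ := hne
    refine (dif_pos (Nat.succ_pos d)).trans ?_
    rw [← hcont w hw 0 (Nat.succ_pos d)]
    exact (Finset.mem_filter.1 (Finset.mem_filter.1 hw).1).2

open Nat in
theorem factorial_mul_pow_le (a j : ℕ) : a ! * a ^ j ≤ j ! * a ^ a := by
  rcases le_total a j with h | h
  · obtain ⟨m, rfl⟩ := Nat.exists_eq_add_of_le h
    have := Nat.factorial_mul_pow_sub_le_factorial h
    rw [Nat.add_sub_cancel_left] at this
    calc a ! * a ^ (a + m) = (a ! * a ^ m) * a ^ a := by ring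
      _ ≤ _ := Nat.mul_le_mul_right _ this
  · obtain ⟨m, rfl⟩ := Nat.exists_eq_add_of_le h
    have h1 := Nat.factorial_mul_descFactorial (n := j + m) (k := m) (by omega)
    rw [Nat.add_sub_cancel] at h1
    have h2 := Nat.descFactorial_le_pow (j + m) m
    calc (j + m)! * (j + m) ^ j ≤ (j ! * (j + m) ^ m) * (j + m) ^ j := by
          rw [← h1]; gcongr
      _ = _ := by rw [pow_add]; ring

/-- In the binomial expansion of `(L + Q) ^ (L + Q)` the term with `L ^ L * Q ^ Q` is the largest of
the `L + Q + 1` terms. -/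
theorem pow_self_le_choose (L Q : ℕ) :
    (L + Q) ^ (L + Q) ≤ (L + Q + 1) * ((L + Q).choose L * (L ^ L * Q ^ Q)) := by
  rw [add_pow]
  refine (Finset.sum_le_card_nsmul _ _ ((L + Q).choose L * (L ^ L * Q ^ Q)) fun j hj => ?_).trans_eq
    (by simp)
  have hj' : j ≤ L + Q := Nat.lt_succ_iff.1 (Finset.mem_range.1 hj)
  obtain ⟨i, hi⟩ := Nat.exists_eq_add_of_le hj'
  rw [hi, Nat.add_sub_cancel_left, ← hi]
  have h1 := factorial_mul_pow_le L j
  have h2 := factorial_mul_pow_le Q i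
  have c1 : (L + Q).choose j * j.factorial * i.factorial = (L + Q).factorial := by
    have := Nat.choose_mul_factorial_mul_factorial hj'
    rwa [show L + Q - j = i by omega] at this
  have c2 : (L + Q).choose L * L.factorial * Q.factorial = (L + Q).factorial := by
    have := Nat.choose_mul_factorial_mul_factorial (Nat.le_add_right L Q)
    rwa [Nat.add_sub_cancel_left] at this
  have hpos : 0 < L.factorial * Q.factorial * (j.factorial * i.factorial) := by positivity
  refine Nat.le_of_mul_le_mul_right ?_ hpos
  calc L ^ j * Q ^ i * (L + Q).choose j * (L.factorial * Q.factorial * (j.factorial * i.factorial))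
      = (L + Q).choose j * j.factorial * i.factorial *
          ((L.factorial * L ^ j) * (Q.factorial * Q ^ i)) := by ring
    _ ≤ (L + Q).choose j * j.factorial * i.factorial *
          ((j.factorial * L ^ L) * (i.factorial * Q ^ Q)) := by gcongr
    _ = (L + Q).choose L * L.factorial * Q.factorial *
          ((j.factorial * L ^ L) * (i.factorial * Q ^ Q)) := by rw [c1, c2]
    _ = _ := by ring

theorem binEntropy_le_log_choose {B L : ℕ} (h0 : 0 < L) (hL : L < B) :
    B * Real.binEntropy (L / B) - Real.log (B + 1) ≤ Real.log (B.choose L) := by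
  obtain ⟨Q, rfl⟩ := Nat.exists_eq_add_of_le hL.le
  have hQ : 0 < Q := by omega
  have hL' : (0 : ℝ) < L := by exact_mod_cast h0
  have hQ' : (0 : ℝ) < Q := by exact_mod_cast hQ
  have hC : (0 : ℝ) < (L + Q).choose L := by exact_mod_cast Nat.choose_pos (Nat.le_add_right L Q)
  have h : ((L + Q : ℝ)) ^ (L + Q) ≤ (L + Q + 1) * ((L + Q).choose L * ((L : ℝ) ^ L * (Q : ℝ) ^ Q)) := by
    exact_mod_cast pow_self_le_choose L Q
  have h2 := Real.log_le_log (by positivity) h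
  rw [Real.log_pow, Real.log_mul (by positivity) (by positivity),
    Real.log_mul (by positivity) (by positivity), Real.log_mul (by positivity) (by positivity),
    Real.log_pow, Real.log_pow] at h2
  have e1 : (1 : ℝ) - L / (L + Q) = Q / (L + Q) := by field_simp; ring
  push_cast at h2 ⊢
  rw [Real.binEntropy, e1, Real.log_inv, Real.log_inv, Real.log_div hL'.ne' (by positivity),
    Real.log_div hQ'.ne' (by positivity)]
  have e2 : ((L : ℝ) + Q) * (L / (L + Q) * -(Real.log L - Real.log (L + Q)) +
      Q / (L + Q) * -(Real.log Q - Real.log (L + Q))) =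
      (L + Q) * Real.log (L + Q) - L * Real.log L - Q * Real.log Q := by field_simp; ring
  rw [e2]
  linarith

end WordCount

/-! ### Exponential growth rates -/

theorem rate_inv (d : ℕ) : rate d (1 / (d + 1 : ℝ)) = Real.log (d + 1) := by
  have h1 : (0 : ℝ) < d + 1 := by positivity
  have e : (1 : ℝ) - 1 / (d + 1) = d / (d + 1) := by field_simp; ring
  rw [rate, Real.binEntropy, e, Real.log_inv, Real.log_inv, one_div, Real.log_inv]
  rcases Nat.eq_zero_or_pos d with rfl | hd
  · simp
  · have : (0 : ℝ) < d := by exact_mod_cast hd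
    rw [Real.log_div this.ne' h1.ne']
    field_simp
    ring

/-- Words of a fixed content with frequency of zeros just above `a`, almost `exp (B * rate d a)` in
number. The frequency is relative to the block length `d + 1 + B`, and the spare `1` pays for the
letters outside the blocks when many blocks are joined. -/
theorem exists_words_log_card {d : ℕ} (hd : 1 ≤ d) {a : ℝ} (ha : 0 < a) (ha1 : a < 1) {η : ℝ}
    (hη : 0 < η) :
    ∃ (B : ℕ) (W : Finset (Fin B → ℕ)) (c : ℕ → ℕ), (∀ w ∈ W, ∀ o, w o < d + 1) ∧
      (∀ w ∈ W, ∀ r < d + 1, (Finset.univ.filter fun o => w o = r).card = c r) ∧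
      a * (d + 1 + B : ℕ) + 1 ≤ c 0 ∧ 0 < W.card ∧
      (rate d a - η) * (d + 1 + B : ℕ) ≤ Real.log W.card := by
  have hd0 : (0 : ℝ) < d := by exact_mod_cast hd
  -- The number of zeros in a word of length `B`.
  set L : ℕ → ℕ := fun B => ⌈a * ((B : ℝ) + (d + 1))⌉₊ + 1 with hLdef
  have hB : Tendsto (fun B : ℕ => (B : ℝ)) atTop atTop := tendsto_natCast_atTop_atTop
  have hBD : Tendsto (fun B : ℕ => (B : ℝ) + (d + 1)) atTop atTop :=
    tendsto_atTop_add_const_right _ _ hB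
  have hinv : Tendsto (fun B : ℕ => 1 / (B : ℝ)) atTop (𝓝 0) := tendsto_one_div_atTop_nhds_zero_nat
  have hratio : Tendsto (fun B : ℕ => ((B : ℝ) + (d + 1)) / B) atTop (𝓝 1) := by
    have h1 : Tendsto (fun B : ℕ => 1 + (d + 1 : ℝ) * (1 / (B : ℝ))) atTop (𝓝 (1 + (d + 1) * 0)) :=
      tendsto_const_nhds.add (hinv.const_mul _)
    rw [mul_zero, add_zero] at h1
    refine h1.congr' ?_
    filter_upwards [eventually_gt_atTop 0] with B hB0
    have : (B : ℝ) ≠ 0 := by exact_mod_cast hB0.ne'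
    field_simp
  have hratio' : Tendsto (fun B : ℕ => (B : ℝ) / ((B : ℝ) + (d + 1))) atTop (𝓝 1) := by
    have := hratio.inv₀ one_ne_zero
    simpa [inv_div] using this
  have hL : Tendsto (fun B : ℕ => (L B : ℝ) / B) atTop (𝓝 a) := by
    have h1 : Tendsto (fun B : ℕ => (⌈a * ((B : ℝ) + (d + 1))⌉₊ : ℝ) / ((B : ℝ) + (d + 1)))
        atTop (𝓝 a) := (tendsto_nat_ceil_mul_div_atTop ha.le).comp hBD
    have h2 := (h1.mul hratio).add hinv
    rw [mul_one, add_zero] at h2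
    refine h2.congr' ?_
    filter_upwards [eventually_gt_atTop 0] with B hB0
    have : (0 : ℝ) < B := by exact_mod_cast hB0
    simp only [hLdef]
    push_cast
    field_simp
  have hlog : Tendsto (fun B : ℕ => Real.log ((B : ℝ) + 1) / ((B : ℝ) + (d + 1))) atTop (𝓝 0) := by
    have h1 : Tendsto (fun x : ℝ => Real.log x / x) atTop (𝓝 0) := by
      have := Real.isLittleO_log_id_atTop.tendsto_div_nhds_zero
      simpa using this
    have h2 := h1.comp (tendsto_atTop_add_const_right _ (1 : ℝ) hB)
    refine squeeze_zero (fun B => ?_) (fun B => ?_) h2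
    · exact div_nonneg (Real.log_nonneg (by linarith [Nat.cast_nonneg (α := ℝ) B])) (by positivity)
    · simp only [Function.comp]
      have : 0 ≤ Real.log ((B : ℝ) + 1) := Real.log_nonneg (by linarith [Nat.cast_nonneg (α := ℝ) B])
      gcongr
      linarith
  have hmain : Tendsto (fun B : ℕ => (B : ℝ) / ((B : ℝ) + (d + 1)) *
      (Real.binEntropy ((L B : ℝ) / B) + (1 - (L B : ℝ) / B) * Real.log d) -
      (d + 2) * (Real.log ((B : ℝ) + 1) / ((B : ℝ) + (d + 1)))) atTop (𝓝 (rate d a)) := by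
    have h1 := (hratio'.mul (((Real.binEntropy_continuous.tendsto a).comp hL).add
      ((hL.const_sub 1).mul_const (Real.log d)))).sub (hlog.const_mul ((d : ℝ) + 2))
    rw [one_mul, mul_zero, sub_zero] at h1
    exact h1
  obtain ⟨B, hB1, hB2, hB3⟩ := ((eventually_gt_atTop 0).and
    ((hL.eventually (gt_mem_nhds ha1)).and
      (hmain.eventually (lt_mem_nhds (sub_lt_self _ hη))))).exists
  have hBpos : (0 : ℝ) < B := by exact_mod_cast hB1
  have hLB : L B < B := by
    rw [div_lt_one hBpos] at hB2
    exact_mod_cast hB2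
  obtain ⟨W, c, h1, h2, h3, h4⟩ := exists_words_same_content (d := d) hd hLB.le
  have hWpos : 0 < W.card := by
    refine Nat.pos_of_ne_zero fun h => ?_
    rw [h, zero_mul] at h4
    have : 0 < B.choose (L B) * d ^ (B - L B) :=
      Nat.mul_pos (Nat.choose_pos hLB.le) (pow_pos hd _)
    omega
  refine ⟨B, W, c, h1, h2, ?_, hWpos, ?_⟩
  · rw [h3]
    have := Nat.le_ceil (a * ((B : ℝ) + (d + 1)))
    simp only [hLdef]
    push_cast
    linarith
  · have hC : (0 : ℝ) < B.choose (L B) := by exact_mod_cast Nat.choose_pos hLB.le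
    have hW : (0 : ℝ) < W.card := by exact_mod_cast hWpos
    have h5 : ((B.choose (L B) : ℝ)) * (d : ℝ) ^ (B - L B) ≤ W.card * ((B : ℝ) + 1) ^ (d + 1) := by
      exact_mod_cast h4
    have h6 := Real.log_le_log (by positivity) h5
    rw [Real.log_mul hC.ne' (by positivity), Real.log_mul hW.ne' (by positivity), Real.log_pow,
      Real.log_pow, Nat.cast_sub hLB.le] at h6
    have h7 := binEntropy_le_log_choose (B := B) (L := L B) (Nat.succ_pos _) hLB
    have hpos : (0 : ℝ) < B + (d + 1) := by positivity
    have h8 := mul_le_mul_of_nonneg_right hB3.le hpos.le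
    have h9 : ((B : ℝ) / ((B : ℝ) + (d + 1)) *
      (Real.binEntropy ((L B : ℝ) / B) + (1 - (L B : ℝ) / B) * Real.log d) -
      (d + 2) * (Real.log ((B : ℝ) + 1) / ((B : ℝ) + (d + 1)))) * (B + (d + 1)) =
      B * Real.binEntropy ((L B : ℝ) / B) + (B - L B) * Real.log d -
        (d + 2) * Real.log ((B : ℝ) + 1) := by
      field_simp
    rw [h9] at h8
    push_cast at h6 ⊢
    linarith

open Classical in
theorem exp_le_card_filter_LIS {d : ℕ} (hd : 1 ≤ d) {a : ℝ} (ha : 0 < a) (ha1 : a < 1) {η : ℝ}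
    (hη : 0 < η) : ∀ᶠ n : ℕ in atTop, Real.exp (n * (2 * rate d a - η)) ≤
      (((avoiders (decreasingPattern (d + 2)) n).filter fun σ => a * n < (LIS σ : ℝ)).card : ℝ) := by
  obtain ⟨B, W, c, h1, h2, h3, h4, h5⟩ :=
    exists_words_log_card hd ha ha1 (half_pos (half_pos hη))
  set K := ∑ r ∈ Finset.range (d + 1), 2 * r * (c r + 1) with hK
  set N := d + 1 + B with hN
  have hN0 : 0 < N := by omega
  set l := rate d a - η / 2 / 2 with hl
  have hev : ∀ᶠ n : ℕ in atTop, 2 * |l| * (K + N) ≤ n * (η / 2) :=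
    (tendsto_natCast_atTop_atTop.atTop_mul_const (half_pos hη)).eventually_ge_atTop _
  filter_upwards [hev, eventually_ge_atTop (K + (K + N) * N)] with n hn1 hn2
  set M := (n - K) / N with hM
  set z := (n - K) % N with hz
  have hMz : M * N + z = n - K := Nat.div_add_mod' _ _
  have hzN : z < N := Nat.mod_lt _ hN0
  have hMge : K + N ≤ M := (Nat.le_div_iff_mul_le hN0).2 (by omega)
  have hcard := pow_card_le_card_avoiders (Nat.succ_pos d) h1 h2 (M := M) (by omega) z n
    (by rw [← hK, ← hN]; omega)
  have hnr : (n : ℝ) = M * N + (K + z) := by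
    have : n = M * N + (K + z) := by omega
    exact_mod_cast this
  have hzr : (z : ℝ) ≤ N := by exact_mod_cast hzN.le
  have hMr : (K + N : ℝ) ≤ M := by exact_mod_cast hMge
  have hKr : (0 : ℝ) ≤ K := Nat.cast_nonneg _
  have hz0 : (0 : ℝ) ≤ z := Nat.cast_nonneg _
  calc Real.exp (n * (2 * rate d a - η)) ≤ Real.exp ((2 * M : ℕ) * Real.log W.card) := by
        rw [Real.exp_le_exp]
        have s1 : (2 * M : ℝ) * (l * N) ≤ (2 * M : ℝ) * Real.log W.card := by gcongr
        have s2 : 2 * (l * (K + z)) ≤ 2 * |l| * (K + N) := by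
          rw [mul_assoc]
          have : l * (K + z) ≤ |l| * (K + N) := by
            calc l * (K + z) ≤ |l| * (K + z) := by gcongr; exact le_abs_self l
              _ ≤ _ := by gcongr
          linarith
        have s3 : (n : ℝ) * (2 * rate d a - η) = 2 * (n * l) - n * (η / 2) := by rw [hl]; ring
        have s4 : (n : ℝ) * l = M * (l * N) + l * (K + z) := by rw [hnr]; ring
        push_cast
        rw [s3, s4]
        linarith
    _ = (W.card : ℝ) ^ (2 * M) := by
        rw [Real.exp_nat_mul, Real.exp_log (by exact_mod_cast h4)]
    _ ≤ _ := by
        have : (W.card : ℝ) ^ (2 * M) ≤ (((avoiders (decreasingPattern (d + 1 + 1)) n).filter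
            fun σ => M * c 0 < LIS σ).card : ℝ) := by exact_mod_cast hcard
        refine this.trans ?_
        norm_cast
        refine Finset.card_le_card (Finset.monotone_filter_right _ fun σ _ hσ => ?_)
        have hlt : (M : ℝ) * c 0 < LIS σ := by exact_mod_cast hσ
        refine lt_of_le_of_lt ?_ hlt
        have t1 : (M : ℝ) * (a * N + 1) ≤ M * c 0 := by gcongr
        have t2 : a * (K + z) ≤ 1 * (K + N) := by gcongr
        rw [hnr]
        linarith

theorem tendsto_root {c : ℕ → ℝ} {G : ℝ} (hup : ∀ n : ℕ, c n ≤ Real.exp (n * G))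
    (hlow : ∀ η : ℝ, 0 < η → ∀ᶠ n : ℕ in atTop, Real.exp (n * (G - η)) ≤ c n) :
    Tendsto (fun n : ℕ => c n ^ (1 / (n : ℝ))) atTop (𝓝 (Real.exp G)) := by
  have hlog : Tendsto (fun n : ℕ => Real.log (c n) * (1 / (n : ℝ))) atTop (𝓝 G) := by
    rw [Metric.tendsto_nhds]
    intro η hη
    filter_upwards [hlow (η / 2) (half_pos hη), eventually_gt_atTop 0] with n hn hn0
    have hn0' : (0 : ℝ) < n := by exact_mod_cast hn0
    have hc : 0 < c n := (Real.exp_pos _).trans_le hn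
    have h1 := (Real.le_log_iff_exp_le hc).2 hn
    have h2 := (Real.log_le_iff_le_exp hc).2 (hup n)
    rw [mul_one_div, Real.dist_eq, abs_lt]
    constructor
    · rw [lt_sub_iff_add_lt, lt_div_iff₀ hn0']; nlinarith
    · rw [sub_lt_iff_lt_add, div_lt_iff₀ hn0']; nlinarith
  refine ((Real.continuous_exp.tendsto G).comp hlog).congr' ?_
  filter_upwards [hlow 1 one_pos] with n hn
  rw [Real.rpow_def_of_pos ((Real.exp_pos _).trans_le hn)]; rfl

theorem tendsto_card_avoiders_root {d : ℕ} (hd : 1 ≤ d) :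
    Tendsto (fun n : ℕ => ((avoiders (decreasingPattern (d + 2)) n).card : ℝ) ^ (1 / (n : ℝ)))
      atTop (𝓝 (Real.exp (2 * Real.log (d + 1)))) := by
  classical
  have hd0 : (0 : ℝ) < d := by exact_mod_cast hd
  refine tendsto_root (fun n => card_avoiders_le_exp) fun η hη => ?_
  have h := exp_le_card_filter_LIS hd (a := 1 / (d + 1 : ℝ)) (by positivity)
    (by rw [div_lt_one (by positivity)]; linarith) hη
  rw [rate_inv] at h
  filter_upwards [h] with n hn
  refine hn.trans ?_
  exact_mod_cast Finset.card_filter_le _ _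

theorem tendsto_avoidProb_root {d : ℕ} (hd : 1 ≤ d) {a : ℝ} (ha : 1 / (d + 1 : ℝ) ≤ a)
    (ha1 : a < 1) :
    Tendsto (fun n : ℕ => avoidProb (decreasingPattern (d + 2)) n
      (fun σ => a * (n : ℝ) < (LIS σ : ℝ)) ^ (1 / (n : ℝ))) atTop
      (𝓝 (Real.exp (2 * rate d a - 2 * Real.log (d + 1)))) := by
  classical
  have ha0 : 0 < a := lt_of_lt_of_le (by positivity) ha
  rw [Real.exp_sub]
  have hnum : Tendsto (fun n : ℕ => (((avoiders (decreasingPattern (d + 2)) n).filter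
      fun σ => a * n < (LIS σ : ℝ)).card : ℝ) ^ (1 / (n : ℝ))) atTop
      (𝓝 (Real.exp (2 * rate d a))) := by
    refine tendsto_root (fun n => le_trans ?_ (card_filter_LIS_le_exp hd n ha ha1)) fun η hη => ?_
    · norm_cast
      exact Finset.card_le_card (Finset.monotone_filter_right _ fun σ _ hσ => le_of_lt hσ)
    · filter_upwards [exp_le_card_filter_LIS hd ha0 ha1 hη] with n hn
      convert hn
  refine (hnum.div (tendsto_card_avoiders_root hd) (Real.exp_ne_zero _)).congr fun n => ?_
  rw [Pi.div_apply, avoidProb, Real.div_rpow (Nat.cast_nonneg _) (Nat.cast_nonneg _)]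

theorem exp_rate_sub_eq {d : ℕ} {ε : ℝ} (hε : 0 < ε) (hεd : ε < d) :
    Real.exp (2 * rate d ((1 + ε) / (d + 1)) - 2 * Real.log (d + 1)) =
      ((1 + ε) ^ (1 + ε) * (1 - ε / d) ^ ((d : ℝ) - ε)) ^ (-(2 / ((d : ℝ) + 1))) := by
  have hd : (0 : ℝ) < d := hε.trans hεd
  have h1 : 0 < 1 + ε := by linarith
  have h2 : 0 < 1 - ε / d := by rw [sub_pos, div_lt_one hd]; exact hεd
  have e : 1 - (1 + ε) / ((d : ℝ) + 1) = d * (1 - ε / d) / (d + 1) := by field_simp; ring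
  rw [Real.rpow_def_of_pos (by positivity), Real.log_mul (by positivity) (by positivity),
    Real.log_rpow h1, Real.log_rpow h2, rate, Real.binEntropy, e, Real.log_inv, Real.log_inv,
    Real.log_div (by positivity) (by positivity), Real.log_div (by positivity) (by positivity),
    Real.log_mul hd.ne' h2.ne']
  congr 1
  generalize Real.log (1 - ε / d) = x
  field_simp
  ring

theorem exp_rate_sub_lt_one {d : ℕ} {ε : ℝ} (hε : 0 < ε) (hεd : ε < d) :
    Real.exp (2 * rate d ((1 + ε) / (d + 1)) - 2 * Real.log (d + 1)) < 1 := by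
  have hd : (0 : ℝ) < d := hε.trans hεd
  have h1 : 0 < 1 + ε := by linarith
  have h2 : 0 < 1 - ε / d := by rw [sub_pos, div_lt_one hd]; exact hεd
  rw [exp_rate_sub_eq hε hεd]
  refine Real.rpow_lt_one_of_one_lt_of_neg ?_ (neg_neg_of_pos (by positivity))
  have key : ∀ x : ℝ, 0 < x → x ≠ 1 → x - 1 < x * Real.log x := fun x hx hx1 => by
    have := Real.log_lt_sub_one_of_pos (inv_pos.2 hx) (inv_ne_one.2 hx1)
    rw [Real.log_inv] at this
    have h3 := mul_lt_mul_of_pos_left this hx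
    rw [mul_sub, mul_inv_cancel₀ hx.ne'] at h3
    linarith
  have k1 := key _ h1 (by linarith)
  have k2 := mul_lt_mul_of_pos_left (key _ h2 (by
    have : 0 < ε / d := by positivity
    linarith)) hd
  have e1 : (d : ℝ) * (1 - ε / d - 1) = -ε := by field_simp; ring
  have e2 : (d : ℝ) * ((1 - ε / d) * Real.log (1 - ε / d)) =
      (d - ε) * Real.log (1 - ε / d) := by field_simp
  rw [e1, e2] at k2
  rw [← Real.log_pos_iff (by positivity), Real.log_mul (by positivity) (by positivity),
    Real.log_rpow h1, Real.log_rpow h2]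
  linarith

/-! ### The lower bound for the longest increasing subsequence -/

section ErdosSzekeres
variable {n : ℕ}

open Classical in
/-- The largest number of points, other than the one at position `i`, on a decreasing subsequence of
`σ` that ends there. -/
noncomputable def decDepth (σ : Equiv.Perm (Fin n)) (i : Fin n) : ℕ :=
  (Finset.univ.filter fun s : Finset (Fin n) =>
    StrictAntiOn σ (s : Set (Fin n)) ∧ ∀ a ∈ s, a < i ∧ σ i < σ a).sup Finset.card

theorem card_le_decDepth {σ : Equiv.Perm (Fin n)} {i : Fin n} {s : Finset (Fin n)}
    (hs : StrictAntiOn σ (s : Set (Fin n))) (h : ∀ a ∈ s, a < i ∧ σ i < σ a) :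
    s.card ≤ decDepth σ i := by
  classical
  rw [decDepth]
  exact Finset.le_sup (f := Finset.card) (by simpa using ⟨hs, h⟩)

theorem exists_card_insert_eq (σ : Equiv.Perm (Fin n)) (i : Fin n) :
    ∃ s : Finset (Fin n), StrictAntiOn σ (s : Set (Fin n)) ∧ (∀ a ∈ s, a ≤ i ∧ σ i ≤ σ a) ∧
      s.card = decDepth σ i + 1 := by
  classical
  obtain ⟨s, hs, h⟩ := Finset.exists_mem_eq_sup
    (Finset.univ.filter fun s : Finset (Fin n) =>
      StrictAntiOn σ (s : Set (Fin n)) ∧ ∀ a ∈ s, a < i ∧ σ i < σ a)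
    ⟨∅, by simp [StrictAntiOn]⟩ Finset.card
  simp only [Finset.mem_filter, Finset.mem_univ, true_and] at hs
  refine ⟨insert i s, ?_, ?_, ?_⟩
  · intro a ha b hb hab
    simp only [Finset.coe_insert, Set.mem_insert_iff, Finset.mem_coe] at ha hb
    rcases ha with rfl | ha <;> rcases hb with rfl | hb
    · exact absurd hab (lt_irrefl _)
    · exact absurd hab (hs.2 b hb).1.asymm
    · exact (hs.2 a ha).2
    · exact hs.1 ha hb hab
  · intro a ha
    rcases Finset.mem_insert.1 ha with rfl | ha
    · exact ⟨le_rfl, le_rfl⟩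
    · exact ⟨(hs.2 a ha).1.le, (hs.2 a ha).2.le⟩
  · rw [Finset.card_insert_of_notMem fun hi => lt_irrefl _ (hs.2 i hi).1, decDepth]
    congr 1
    convert h.symm

theorem decDepth_lt {σ : Equiv.Perm (Fin n)} {i j : Fin n} (hij : i < j) (hσ : σ j < σ i) :
    decDepth σ i < decDepth σ j := by
  obtain ⟨s, hs, h, hc⟩ := exists_card_insert_eq σ i
  have := card_le_decDepth hs fun a ha =>
    ⟨(h a ha).1.trans_lt hij, hσ.trans_le (h a ha).2⟩
  omega

theorem decDepth_lt_of_mem {d : ℕ} {σ : Equiv.Perm (Fin n)}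
    (hσ : σ ∈ avoiders (decreasingPattern (d + 1)) n) (i : Fin n) : decDepth σ i < d := by
  obtain ⟨s, hs, -, hc⟩ := exists_card_insert_eq σ i
  by_contra hlt
  refine mem_avoiders.1 hσ ⟨s.orderEmbOfCardLe (k := d + 1) (by omega),
    (s.orderEmbOfCardLe _).strictMono, fun a b => ?_⟩
  simp only [decreasingPattern, Fin.revPerm_apply, Fin.rev_lt_rev]
  rw [hs.lt_iff_gt (Finset.orderEmbOfCardLe_mem s _ a) (Finset.orderEmbOfCardLe_mem s _ b)]
  exact (s.orderEmbOfCardLe _).lt_iff_lt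

/-- The positions of equal depth form increasing subsequences, and there are at most `d` depths. -/
theorem le_LIS_mul {d : ℕ} {σ : Equiv.Perm (Fin n)}
    (hσ : σ ∈ avoiders (decreasingPattern (d + 1)) n) : n ≤ LIS σ * d := by
  classical
  have h := Finset.card_le_mul_card_image_of_maps_to (s := Finset.univ) (t := Finset.range d)
    (f := decDepth σ) (fun i _ => Finset.mem_range.2 (decDepth_lt_of_mem hσ i)) (LIS σ)
    fun r _ => le_LIS fun i hi j hj hij => by
      simp only [Finset.coe_filter, Finset.mem_univ, true_and, Set.mem_ofPred_eq] at hi hj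
      by_contra hlt
      rcases (not_lt.1 hlt).lt_or_eq with h1 | h1
      · have := decDepth_lt hij h1
        omega
      · exact hij.ne' (σ.injective h1)
  simpa using h

end ErdosSzekeres

/-! ### Probabilities -/

theorem avoidProb_eq_zero {k n : ℕ} {τ : Equiv.Perm (Fin k)} {E : Equiv.Perm (Fin n) → Prop}
    (h : ∀ σ ∈ avoiders τ n, ¬ E σ) : avoidProb τ n E = 0 := by
  classical
  rw [avoidProb, Finset.filter_false_of_mem h]
  simp

theorem avoidProb_nonneg {k n : ℕ} (τ : Equiv.Perm (Fin k)) (E : Equiv.Perm (Fin n) → Prop) :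
    0 ≤ avoidProb τ n E := by
  rw [avoidProb]; positivity

theorem avoidProb_mono {k n : ℕ} {τ : Equiv.Perm (Fin k)} {E F : Equiv.Perm (Fin n) → Prop}
    (h : ∀ σ ∈ avoiders τ n, E σ → F σ) : avoidProb τ n E ≤ avoidProb τ n F := by
  classical
  rw [avoidProb, avoidProb]
  gcongr with σ hσ
  exact h σ hσ

theorem tendsto_zero_of_root {c : ℕ → ℝ} (hc : ∀ n, 0 ≤ c n) {g : ℝ} (hg : g < 1)
    (h : Tendsto (fun n : ℕ => c n ^ (1 / (n : ℝ))) atTop (𝓝 g)) : Tendsto c atTop (𝓝 0) := by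
  obtain ⟨q, hq, hq1⟩ := exists_between (max_lt hg one_pos)
  have hq0 : 0 ≤ q := (le_max_right _ _).trans hq.le
  refine squeeze_zero' (Eventually.of_forall hc) ?_ (tendsto_pow_atTop_nhds_zero_of_lt_one hq0 hq1)
  filter_upwards [h.eventually (gt_mem_nhds ((le_max_left _ _).trans_lt hq)),
    eventually_gt_atTop 0] with n hn hn0
  have := pow_le_pow_left₀ (Real.rpow_nonneg (hc n) _) hn.le n
  rwa [one_div, Real.rpow_inv_natCast_pow (hc n) hn0.ne'] at this

theorem theorem3 (k : ℕ) (hk : 2 ≤ k) :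
    (∀ ε : ℝ, 0 < ε → ε < (k : ℝ) - 2 →
      Tendsto
        (fun n : ℕ =>
          (avoidProb (decreasingPattern k) n
            (fun σ => (1 + ε) / ((k : ℝ) - 1) * (n : ℝ) < (LIS σ : ℝ))) ^ (1 / (n : ℝ)))
        atTop
        (𝓝 (((1 + ε) ^ (1 + ε) *
          (1 - ε / ((k : ℝ) - 2)) ^ ((k : ℝ) - 2 - ε)) ^ (-(2 / ((k : ℝ) - 1)))))) ∧
    (∀ n : ℕ,
      avoidProb (decreasingPattern k) n
        (fun σ => (LIS σ : ℝ) < (n : ℝ) / ((k : ℝ) - 1)) = 0) ∧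
    (∀ δ : ℝ, 0 < δ →
      Tendsto
        (fun n : ℕ =>
          avoidProb (decreasingPattern k) n
            (fun σ => δ ≤ |(LIS σ : ℝ) / (n : ℝ) - 1 / ((k : ℝ) - 1)|))
        atTop (𝓝 0)) := by
  obtain ⟨d, rfl⟩ : ∃ d, k = d + 2 := ⟨k - 2, by omega⟩
  have e1 : ((d + 2 : ℕ) : ℝ) - 1 = d + 1 := by push_cast; ring
  have e2 : ((d + 2 : ℕ) : ℝ) - 2 = d := by push_cast; ring
  rw [e1, e2]
  have hd1 : (0 : ℝ) < d + 1 := by positivity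
  have hroot : ∀ ε : ℝ, 0 < ε → ε < d → Tendsto
      (fun n : ℕ => (avoidProb (decreasingPattern (d + 2)) n
        (fun σ => (1 + ε) / ((d : ℝ) + 1) * (n : ℝ) < (LIS σ : ℝ))) ^ (1 / (n : ℝ))) atTop
      (𝓝 (Real.exp (2 * rate d ((1 + ε) / (d + 1)) - 2 * Real.log (d + 1)))) := by
    intro ε hε hεd
    have hd : 1 ≤ d := by
      have : (0 : ℝ) < d := hε.trans hεd
      exact_mod_cast this
    refine tendsto_avoidProb_root hd ?_ ?_
    · gcongr; linarith
    · rw [div_lt_one hd1]; linarith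
  have hlow : ∀ (n : ℕ), ∀ σ ∈ avoiders (decreasingPattern (d + 2)) n,
      (n : ℝ) / (d + 1) ≤ LIS σ := by
    intro n σ hσ
    rw [div_le_iff₀ hd1]
    exact_mod_cast le_LIS_mul hσ
  refine ⟨fun ε hε hεd => ?_, fun n => avoidProb_eq_zero fun σ hσ => not_lt.2 (hlow n σ hσ),
    fun δ hδ => ?_⟩
  · rw [← exp_rate_sub_eq hε hεd]
    exact hroot ε hε hεd
  · have hlow' : ∀ n : ℕ, 0 < n → ∀ σ ∈ avoiders (decreasingPattern (d + 2)) n,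
        0 ≤ (LIS σ : ℝ) / n - 1 / (d + 1) := by
      intro n hn σ hσ
      have hn' : (0 : ℝ) < n := by exact_mod_cast hn
      rw [sub_nonneg, div_le_div_iff₀ hd1 hn']
      have := hlow n σ hσ
      rw [div_le_iff₀ hd1] at this
      linarith
    rcases Nat.eq_zero_or_pos d with rfl | hd
    -- For the pattern `21` only the identity is left, and `LIS σ = n`.
    · refine tendsto_const_nhds.congr' ?_
      filter_upwards [eventually_gt_atTop 0] with n hn
      refine (avoidProb_eq_zero fun σ hσ => ?_).symm
      have hn' : (0 : ℝ) < n := by exact_mod_cast hn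
      have h1 := hlow' n hn σ hσ
      have h2 : (LIS σ : ℝ) / n ≤ 1 := by
        rw [div_le_one hn']; exact_mod_cast LIS_le σ
      rw [abs_of_nonneg h1, not_le]
      simp only [Nat.cast_zero, zero_add, div_one] at h1 ⊢
      linarith
    · have hd0 : (0 : ℝ) < d := by exact_mod_cast hd
      -- Small enough that the first part applies and `(1 + ε) / (d + 1) < 1 / (d + 1) + δ`.
      set ε : ℝ := min (d / 2) (δ * (d + 1) / 2) with hε
      have hε0 : 0 < ε := lt_min (by positivity) (by positivity)
      have hεd : ε < d := (min_le_left _ _).trans_lt (by linarith)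
      have hεδ : ε ≤ δ * (d + 1) / 2 := min_le_right _ _
      have hz := tendsto_zero_of_root (fun n => avoidProb_nonneg _ _)
        (exp_rate_sub_lt_one hε0 hεd) (hroot ε hε0 hεd)
      refine squeeze_zero' (Eventually.of_forall fun n => avoidProb_nonneg _ _) ?_ hz
      filter_upwards [eventually_gt_atTop 0] with n hn
      refine avoidProb_mono fun σ hσ hdev => ?_
      have hn' : (0 : ℝ) < n := by exact_mod_cast hn
      rw [abs_of_nonneg (hlow' n hn σ hσ)] at hdev
      rw [← lt_div_iff₀ hn']
      have : (1 + ε) / ((d : ℝ) + 1) < 1 / (d + 1) + δ := by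
        rw [add_div, add_lt_add_iff_left, div_lt_iff₀ hd1]
        nlinarith
      linarith
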